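/- Let $d,m\ge 1$ be integers, let $\mathcal H_1,\dots,\mathcal H_m$ be finite dimensional Hilbert spaces over $\mathbf F\in\{\mathbf R,\mathbf C\}$, let $\mathcal H=\bigotimes_{j=1}^m\mathcal H_j$ be their Hilbert space tensor product (so $\langle\bigotimes_j u_j,\bigotimes_j v_j\rangle=\prod_j\langle u_j,v_j\rangle$), and set $n=\dim\mathcal H=\prod_j\dim\mathcal H_j$. Let $\vec p\in[1,\infty]^m$ and $\frac1p=\sum_j\frac1{p_j}$ (so $0<p\le\infty$). Let $\vec W=(W_1,\dots,W_m)$ be matrix weights, i.e. measurable maps $W_j:\mathbf R^d\to\mathcal L(\mathcal H_j)$ such that $W_j(x)$ is self-adjoint and positive definite for a.e. $x$, and let $\mathbf W(x)=\bigotimes_jW_j(x)$. A cube is a set $Q=\prod_{i=1}^d[a_i,a_i+\ell)$ with $\ell>0$, and $\langle f\rangle_Q=\frac1{|Q|}\int_Qf$. *Spaces.* For a finite dimensional Hilbert space $\mathcal V$ over $\mathbf F$, let $\mathcal K(\mathcal V)$ be the family of nonempty closed convex sets $K\subseteq\mathcal V$ with $\lambda K\subseteq K$ for all $\lambda\in\mathbf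 F$, $|\lambda|=1$; for $S\subseteq\mathcal V$ let $\mathcal K(S)$ be the smallest member of $\mathcal K(\mathcal V)$ containing $S$. A set-valued map $F$ on $\mathbf R^d$ is measurable if $\{x:F(x)\cap U\ne\emptyset\}$ is Lebesgue measurable for every open $U\subseteq\mathcal V$. For a matrix weight $W$ on $\mathcal V$ put $\|f\|_{L^q_W(\mathbf R^d;\mathcal V)}=\big\|\,\|Wf\|_{\mathcal V}\big\|_{L^q(\mathbf R^d)}$ for measurable $f:\mathbf R^d\to\mathcal V$, and $\|F\|_{L^q_W(\mathbf R^d;\mathcal K(\mathcal V))}=\big\|x\mapsto\sup_{u\in F(x)}\|W(x)u\|_{\mathcal V}\big\|_{L^q(\mathbf R^d)}$ for measurable $F:\mathbf R^d\to\mathcal K(\mathcal V)$; the spaces consist of those $f$, respectively $F$, with finite norm. For a measurable closed-set-valued map $G$ put $$\|G\|_{L^q_W(\mathbf R^d;\mathcal K(\mathcal V))_{\mathrm{weak}}}=\sup_{u\in\mathcal V}\big\|\mathbf 1_{\{x:\,u\in G(x)\}}\,u\big\|_{L^q_W(\mathbf R^d;\mathcal V)}.$$ *Muckenhoupt condition.*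 With $T_Q\vec f=\mathbf 1_Q\bigotimes_{j=1}^m\langle f_j\rangle_Q$, let $$[\vec W]_{\vec p}=\sup_Q\|T_Q\|_{L^{p_1}_{W_1}(\mathbf R^d;\mathcal H_1)\times\cdots\times L^{p_m}_{W_m}(\mathbf R^d;\mathcal H_m)\to L^p_{\mathbf W}(\mathbf R^d;\mathcal H)},$$ where the supremum is over all cubes. We write $\vec W\in A_{\vec p}$ if $W_j^{-1}$ is locally $p_j'$-integrable for every $j$ (locally essentially bounded if $p_j=1$) and $[\vec W]_{\vec p}<\infty$. *Maximal operator.* A measurable $F:\mathbf R^d\to\mathcal K(\mathcal V)$ is in $L^1_{\mathrm{loc}}(\mathbf R^d;\mathcal K(\mathcal V))$ if $\int_Q\sup_{u\in F(x)}\|u\|\,dx<\infty$ for all cubes $Q$; then $\langle F\rangle_Q$ denotes the set of all $\langle f\rangle_Q$, where $f$ is measurable with $f(x)\in F(x)$ for a.e. $x\in Q$. For $F_j\in L^1_{\mathrm{loc}}(\mathbf R^d;\mathcal K(\mathcal H_j))$, $j=1,\dots,m$, let $$M\vec F(x)=\overline{\bigcup_{Q\text{ cube}}\mathcal K\Big(\bigotimes_{j=1}^m\langle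 F_j\rangle_Q\Big)\mathbf 1_Q(x)},\qquad \bigotimes_{j=1}^m\langle F_j\rangle_Q=\Big\{\bigotimes_{j=1}^m u_j:\ u_j\in\langle F_j\rangle_Q\Big\}.$$ **Proposition.** The following are equivalent: (i) $\vec W\in A_{\vec p}$; (ii) $M$ is bounded from $\prod_{j=1}^mL^{p_j}_{W_j}(\mathbf R^d;\mathcal K(\mathcal H_j))$ to $L^p_{\mathbf W}(\mathbf R^d;\mathcal K(\mathcal H))_{\mathrm{weak}}$; that is, there is $C<\infty$ such that for all $\vec F$ in the domain each $F_j$ is in $L^1_{\mathrm{loc}}(\mathbf R^d;\mathcal K(\mathcal H_j))$ (so $M\vec F$ is defined), $M\vec F$ is measurable, and $$\|M\vec F\|_{L^p_{\mathbf W}(\mathbf R^d;\mathcal K(\mathcal H))_{\mathrm{weak}}}\le C\prod_{j=1}^m\|F_j\|_{L^{p_j}_{W_j}(\mathbf R^d;\mathcal K(\mathcal H_j))}.$$ Moreover, there is a constant $C_{d,n,m}$ that depends only on $d$, $n$, $m$ such that in this case, with $\|M\|$ the least $C$ in (ii), $$C_{d,n,m}^{-1}\,[\vec W]_{\vec p}\le\|M\|\le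 C_{d,n,m}\,[\vec W]_{\vec p}.$$ -/

import Mathlib

open MeasureTheory
open scoped ENNReal NNReal

namespace TensorMax

universe u v

/-! ### The Hilbert space tensor product of finitely many finite dimensional Hilbert spaces -/

section Tensor

variable (𝕜 : Type u) [RCLike 𝕜] {m : ℕ} (H : Fin m → Type v)
  [∀ j, NormedAddCommGroup (H j)] [∀ j, InnerProductSpace 𝕜 (H j)]

/-- The algebraic tensor product of the spaces `H j`. It is a separate type because Mathlib puts the
projective norm on `PiTensorProduct`, whereas the Hilbert space norm is needed here. -/
def HilbertTensor : Type (max u v) := PiTensorProduct 𝕜 H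

noncomputable instance : AddCommGroup (HilbertTensor 𝕜 H) :=
  inferInstanceAs (AddCommGroup (PiTensorProduct 𝕜 H))

noncomputable instance : Module 𝕜 (HilbertTensor 𝕜 H) :=
  inferInstanceAs (Module 𝕜 (PiTensorProduct 𝕜 H))

/-- The elementary tensor `⨂ⱼ uⱼ`, as a multilinear map of `u`. -/
noncomputable def tensor : MultilinearMap 𝕜 H (HilbertTensor 𝕜 H) :=
  PiTensorProduct.tprod 𝕜

/-- The operator `⨂ⱼ Lⱼ`, characterised by `(⨂ⱼ Lⱼ) (⨂ⱼ uⱼ) = ⨂ⱼ (Lⱼ uⱼ)`. -/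
noncomputable def tensorMap (L : ∀ j, H j →L[𝕜] H j) :
    HilbertTensor 𝕜 H →ₗ[𝕜] HilbertTensor 𝕜 H :=
  PiTensorProduct.map (fun j => (L j : H j →ₗ[𝕜] H j))

theorem tensorMap_tensor (L : ∀ j, H j →L[𝕜] H j) (u : ∀ j, H j) :
    tensorMap 𝕜 H L (tensor 𝕜 H u) = tensor 𝕜 H (fun j => L j (u j)) :=
  PiTensorProduct.map_tprod _ _

variable [∀ j, FiniteDimensional 𝕜 (H j)]

/-- The basis of the tensor product that is made of the elementary tensors of the members of
orthonormal bases of the factors. -/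
noncomputable def tensorBasis :
    Module.Basis (∀ j, Fin (Module.finrank 𝕜 (H j))) 𝕜 (HilbertTensor 𝕜 H) :=
  Basis.piTensorProduct (fun j => (stdOrthonormalBasis 𝕜 (H j)).toBasis)

/-- The inner product for which `tensorBasis` is orthonormal. By `inner_tensor` below it is
the sesquilinear form with `⟪⨂ⱼ uⱼ, ⨂ⱼ vⱼ⟫ = ∏ⱼ ⟪uⱼ, vⱼ⟫`. -/
noncomputable abbrev tensorCore : InnerProductSpace.Core 𝕜 (HilbertTensor 𝕜 H) where
  inner x y := ∑ k, (starRingEnd 𝕜) ((tensorBasis 𝕜 H).repr x k) * (tensorBasis 𝕜 H).repr y k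
  conj_inner_symm x y := by simp [map_sum, mul_comm]
  re_inner_nonneg x := by
    rw [map_sum]
    refine Finset.sum_nonneg fun k _ => ?_
    rw [RCLike.conj_mul]
    norm_cast
    positivity
  add_left x y z := by simp [add_mul, Finset.sum_add_distrib]
  smul_left x y r := by simp [Finset.mul_sum, mul_assoc]
  definite x hx := by
    have h : ∑ k, ‖(tensorBasis 𝕜 H).repr x k‖ ^ 2 = (0 : ℝ) := by
      simp only [RCLike.conj_mul] at hx
      exact_mod_cast hx
    rw [Finset.sum_eq_zero_iff_of_nonneg (fun _ _ => by positivity)] at h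
    refine (tensorBasis 𝕜 H).ext_elem fun k => ?_
    simpa using h k (Finset.mem_univ k)

noncomputable instance : NormedAddCommGroup (HilbertTensor 𝕜 H) :=
  (tensorCore 𝕜 H).toNormedAddCommGroup

noncomputable instance : InnerProductSpace 𝕜 (HilbertTensor 𝕜 H) :=
  InnerProductSpace.ofCore (tensorCore 𝕜 H).toCore

theorem inner_tensor (u v : ∀ j, H j) :
    inner 𝕜 (tensor 𝕜 H u) (tensor 𝕜 H v) = ∏ j, inner 𝕜 (u j) (v j) := by
  have h1 : inner 𝕜 (tensor 𝕜 H u) (tensor 𝕜 H v) =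
      ∑ k, (starRingEnd 𝕜) ((tensorBasis 𝕜 H).repr (tensor 𝕜 H u) k) *
        (tensorBasis 𝕜 H).repr (tensor 𝕜 H v) k := rfl
  have h2 : ∀ (w : ∀ j, H j) k, (tensorBasis 𝕜 H).repr (tensor 𝕜 H w) k =
      ∏ j, inner 𝕜 (stdOrthonormalBasis 𝕜 (H j) (k j)) (w j) := by
    intro w k
    refine (Basis.piTensorProduct_repr_tprod_apply _ w k).trans ?_
    simp [OrthonormalBasis.coe_toBasis_repr_apply, OrthonormalBasis.repr_apply_apply]
  simp only [h1, h2, map_prod, inner_conj_symm, ← Finset.prod_mul_distrib]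
  rw [← Fintype.piFinset_univ]
  refine (Finset.prod_univ_sum (fun _ => Finset.univ) fun j i =>
    inner 𝕜 (u j) (stdOrthonormalBasis 𝕜 (H j) i) *
      inner 𝕜 (stdOrthonormalBasis 𝕜 (H j) i) (v j)).symm.trans ?_
  exact Finset.prod_congr rfl fun j _ =>
    (stdOrthonormalBasis 𝕜 (H j)).sum_inner_mul_inner (u j) (v j)

end Tensor

/-! ### Cubes, convex bodies and set-valued mappings -/

/-- `ℝᵈ`. -/
abbrev E (d : ℕ) : Type := EuclideanSpace ℝ (Fin d)

/-- The cube `∏ᵢ [aᵢ, aᵢ + l)`. -/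
def cube {d : ℕ} (a : E d) (l : ℝ) : Set (E d) :=
  {x | ∀ i, a i ≤ x i ∧ x i < a i + l}

/-- `Q` is a (nondegenerate) cube with sides parallel to the coordinate axes. -/
def IsCube {d : ℕ} (Q : Set (E d)) : Prop :=
  ∃ (a : E d) (l : ℝ), 0 < l ∧ Q = cube a l

section Bodies

variable (𝕜 : Type u) [RCLike 𝕜] {d : ℕ} {V : Type v} [NormedAddCommGroup V]
  [InnerProductSpace 𝕜 V]

/-- `K ∈ 𝒦(V)`: `K` is nonempty, closed, convex, and symmetric with respect to the scalars
of modulus one. -/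
structure IsBody (K : Set V) : Prop where
  nonempty : K.Nonempty
  isClosed : IsClosed K
  convex : ∀ u ∈ K, ∀ v ∈ K, ∀ t : ℝ, 0 ≤ t → t ≤ 1 →
    ((1 - t : ℝ) : 𝕜) • u + (t : 𝕜) • v ∈ K
  symm : ∀ u ∈ K, ∀ c : 𝕜, ‖c‖ = 1 → c • u ∈ K

/-- `𝒦(S)`: the smallest member of `𝒦(V)` that contains `S`. -/
def bodyHull (S : Set V) : Set V :=
  ⋂₀ {K | IsBody 𝕜 K ∧ S ⊆ K}

/-- `F` is a (Lebesgue) measurable set-valued mapping. -/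
def MeasurableSetMap (F : E d → Set V) : Prop :=
  ∀ U : Set V, IsOpen U → NullMeasurableSet {x | (F x ∩ U).Nonempty}

/-- `F ∈ L⁰(ℝᵈ; 𝒦(V))`. -/
structure IsBodyMap (F : E d → Set V) : Prop where
  isBody : ∀ x, IsBody 𝕜 (F x)
  measurable : MeasurableSetMap F

/-- `F ∈ L¹_loc(ℝᵈ; 𝒦(V))`. -/
def LocIntegrableBodyMap (F : E d → Set V) : Prop :=
  IsBodyMap 𝕜 F ∧ ∀ Q : Set (E d), IsCube Q → ∫⁻ x in Q, (⨆ u ∈ F x, ‖u‖ₑ) < ∞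

/-- The average of a function over `Q`. -/
noncomputable def avg (Q : Set (E d)) (f : E d → V) : V :=
  letI : NormedSpace ℝ V := NormedSpace.restrictScalars ℝ 𝕜 V
  ⨍ x in Q, f x

/-- The Aumann average `⟨F⟩_Q`: all averages over `Q` of the measurable selections of `F`. -/
def aumannAvg (Q : Set (E d)) (F : E d → Set V) : Set V :=
  {v | ∃ f : E d → V, AEStronglyMeasurable f (volume.restrict Q) ∧
    (∀ᵐ x ∂(volume.restrict Q), f x ∈ F x) ∧ v = avg 𝕜 Q f}

/-! ### Matrix weights and matrix weighted Lebesgue spaces -/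

/-- `W` is a matrix weight: it is measurable, and `W x` is self-adjoint and positive definite for
almost every `x`. -/
structure IsMatrixWeight (W : E d → V →L[𝕜] V) : Prop where
  measurable : AEStronglyMeasurable W volume
  selfAdjoint : ∀ᵐ x, (W x : V →ₗ[𝕜] V).IsSymmetric
  pos : ∀ᵐ x, ∀ u : V, u ≠ 0 → 0 < RCLike.re (inner 𝕜 (W x u) u)

variable {𝕜}

/-- `‖f‖_{L^p_W(ℝᵈ; V)} = ‖ ‖W f‖_V ‖_{L^p(ℝᵈ)}`. -/
noncomputable def wNorm (p : ℝ≥0∞) (W : E d → V →ₗ[𝕜] V) (f : E d → V) : ℝ≥0∞ :=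
  eLpNorm (fun x => W x (f x)) p volume

/-- `f ∈ L^p_W(ℝᵈ; V)`. -/
def MemW (p : ℝ≥0∞) (W : E d → V →ₗ[𝕜] V) (f : E d → V) : Prop :=
  AEStronglyMeasurable f volume ∧ wNorm p W f < ∞

/-- `‖F‖_{L^p_W(ℝᵈ; 𝒦(V))}`: the `L^p`-norm of `x ↦ sup {‖W x u‖ : u ∈ F x}`. -/
noncomputable def wBodyNorm (p : ℝ≥0∞) (W : E d → V →ₗ[𝕜] V) (F : E d → Set V) : ℝ≥0∞ :=
  eLpNorm (fun x => ⨆ u ∈ F x, ‖W x u‖ₑ) p volume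

/-- `F ∈ L^p_W(ℝᵈ; 𝒦(V))`. -/
def MemWBody (p : ℝ≥0∞) (W : E d → V →ₗ[𝕜] V) (F : E d → Set V) : Prop :=
  IsBodyMap 𝕜 F ∧ wBodyNorm p W F < ∞

/-- The weak-type quasinorm: the supremum over `u : V` of the `L^p_W(ℝᵈ; V)`-quasinorm of
`𝟙_{x : u ∈ G x} u`. -/
noncomputable def weakNorm (p : ℝ≥0∞) (W : E d → V →ₗ[𝕜] V) (G : E d → Set V) : ℝ≥0∞ :=
  ⨆ u : V, wNorm p W ({x | u ∈ G x}.indicator fun _ => u)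

end Bodies

/-! ### The Muckenhoupt condition and the tensor product maximal operator -/

section Main

variable {𝕜 : Type u} [RCLike 𝕜] {d m : ℕ} {H : Fin m → Type v}
  [∀ j, NormedAddCommGroup (H j)] [∀ j, InnerProductSpace 𝕜 (H j)]
  [∀ j, FiniteDimensional 𝕜 (H j)]

/-- The exponent `p` with `1 / p = ∑ⱼ 1 / pⱼ`. -/
noncomputable def totalExp (p : Fin m → ℝ≥0∞) : ℝ≥0∞ := (∑ j, (p j)⁻¹)⁻¹

/-- The weight `𝐖 = ⨂ⱼ Wⱼ`. -/
noncomputable def tensorWeight (W : ∀ j, E d → H j →L[𝕜] H j) :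
    E d → HilbertTensor 𝕜 H →ₗ[𝕜] HilbertTensor 𝕜 H :=
  fun x => tensorMap 𝕜 H fun j => W j x

/-- The averaging operator `T_Q f = (⨂ⱼ ⟨fⱼ⟩_Q) 𝟙_Q`. -/
noncomputable def avgOp (Q : Set (E d)) (f : ∀ j, E d → H j) : E d → HilbertTensor 𝕜 H :=
  Q.indicator fun _ => tensor 𝕜 H fun j => avg 𝕜 Q (f j)

/-- The operator norm of `T_Q : L^{p₁}_{W₁} × ⋯ × L^{pₘ}_{Wₘ} → L^p_𝐖`. -/
noncomputable def avgOpNorm (p : Fin m → ℝ≥0∞) (W : ∀ j, E d → H j →L[𝕜] H j)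
    (Q : Set (E d)) : ℝ≥0∞ :=
  sInf {C : ℝ≥0∞ | ∀ f : ∀ j, E d → H j,
    (∀ j, MemW (p j) (fun x => (W j x : H j →ₗ[𝕜] H j)) (f j)) →
    wNorm (totalExp p) (tensorWeight W) (avgOp Q f) ≤
      C * ∏ j, wNorm (p j) (fun x => (W j x : H j →ₗ[𝕜] H j)) (f j)}

/-- The Muckenhoupt constant `[W]_p`, the supremum of the norms of `T_Q` over all cubes `Q`. -/
noncomputable def muckenhoupt (p : Fin m → ℝ≥0∞) (W : ∀ j, E d → H j →L[𝕜] H j) : ℝ≥0∞ :=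
  ⨆ (Q : Set (E d)) (_ : IsCube Q), avgOpNorm p W Q

/-- The condition `W ∈ A_p`: every `Wⱼ⁻¹` is locally `pⱼ'`-integrable, and `[W]_p < ∞`. -/
def IsMuckenhoupt (p : Fin m → ℝ≥0∞) (W : ∀ j, E d → H j →L[𝕜] H j) : Prop :=
  (∀ j, ∀ Q : Set (E d), IsCube Q →
    MemLp (fun x => Ring.inverse (W j x)) (ENNReal.conjExponent (p j)) (volume.restrict Q)) ∧
  muckenhoupt p W < ∞

/-- The tensor product maximal operator: `M F x` is the closure of
`⋃_Q 𝒦(⨂ⱼ ⟨Fⱼ⟩_Q) 𝟙_Q(x)`, where `Q` runs through all cubes. -/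
noncomputable def maximalOp (F : ∀ j, E d → Set (H j)) (x : E d) : Set (HilbertTensor 𝕜 H) :=
  closure (⋃ (Q : Set (E d)) (_ : IsCube Q),
    (fun w => Q.indicator (fun _ => w) x) ''
      bodyHull 𝕜 {w | ∃ u : ∀ j, H j, (∀ j, u j ∈ aumannAvg 𝕜 Q (F j)) ∧ w = tensor 𝕜 H u})

/-- `M` is a bounded operator from `L^{p₁}_{W₁}(𝒦(H₁)) × ⋯ × L^{pₘ}_{Wₘ}(𝒦(Hₘ))` into
`L^p_𝐖(𝒦(H))_weak`: it is defined on the whole domain (which means local integrability), and has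
measurable values of weak-type quasinorm at most a constant times the product of the norms. -/
def MaximalBounded (p : Fin m → ℝ≥0∞) (W : ∀ j, E d → H j →L[𝕜] H j) : Prop :=
  ∃ C : ℝ≥0, ∀ F : ∀ j, E d → Set (H j),
    (∀ j, MemWBody (p j) (fun x => (W j x : H j →ₗ[𝕜] H j)) (F j)) →
    (∀ j, LocIntegrableBodyMap 𝕜 (F j)) ∧
    MeasurableSetMap (maximalOp (𝕜 := 𝕜) F) ∧
    weakNorm (totalExp p) (tensorWeight W) (maximalOp F) ≤
      C * ∏ j, wBodyNorm (p j) (fun x => (W j x : H j →ₗ[𝕜] H j)) (F j)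

/-- The operator norm of `M` from `L^{p₁}_{W₁}(𝒦(H₁)) × ⋯ × L^{pₘ}_{Wₘ}(𝒦(Hₘ))` into
`L^p_𝐖(𝒦(H))_weak`. -/
noncomputable def maximalOpNorm (p : Fin m → ℝ≥0∞) (W : ∀ j, E d → H j →L[𝕜] H j) : ℝ≥0∞ :=
  sInf {C : ℝ≥0∞ | ∀ F : ∀ j, E d → Set (H j),
    (∀ j, MemWBody (p j) (fun x => (W j x : H j →ₗ[𝕜] H j)) (F j)) →
    weakNorm (totalExp p) (tensorWeight W) (maximalOp F) ≤
      C * ∏ j, wBodyNorm (p j) (fun x => (W j x : H j →ₗ[𝕜] H j)) (F j)}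

end Main

end TensorMax

/-! From (ii) to (i), `M` is tested on the disks `{c • fⱼ x : ‖c‖ ≤ 1}`. On a cube `Q` the vector
`⨂ⱼ ⟨fⱼ⟩_Q` lies in the value of `M`, so the weak norm dominates the norm of `T_Q f`, and `[W]_p ≤
‖M‖` with constant one (`muckenhoupt_le_maximalOpNorm`). Integrability of `Wⱼ⁻¹` comes from the
requirement that `M` be defined on the whole domain: every body map of finite weighted norm is
locally integrable, and a resonance argument followed by duality turns this into `Wⱼ⁻¹ ∈ L^{pⱼ'}` on
cubes (`memLp_inverse_of_lintegral_iSup_lt_top`).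

From (i) to (ii), fix `u ≠ 0`. If `u ∈ M F x`, then some cube `Q ∋ x` has a vector `v` close to `u`
that is a convex combination of unimodular multiples of elements of `⨂ⱼ ⟨Fⱼ⟩_Q`. Carathéodory's
theorem needs at most `2n + 1` of them, and each is controlled on the fivefold cube by applying
`T_{5Q}` to selections cut off to `Q`. Hence `‖𝐖 v‖` has `L^p` quasinorm on `5Q` at most a constant
times `[W]_p ∏ⱼ ‖Fⱼ‖_{L^{pⱼ}(Q)}` (`eLpNorm_tensorWeight_convexHull_le`). On sets where the weight
is bounded above and `‖𝐖 u‖` is bounded below, `v` may replace `u` at the cost of a factor two.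
Vitali's lemma selects disjoint cubes whose enlargements cover, and Hölder's inequality for sums
with exponents `p / pⱼ` adds up the local bounds (`eLpNorm_restrict_biUnion_cube_le`). Exhaustion
removes the restrictions on the side lengths and on the weight.

Measurability of `M F` reduces to that of an uncountable union of cubes, which holds by Lebesgue
density (`nullMeasurableSet_sUnion_of_convex`). -/

namespace TensorMax

open Set Filter Metric Topology


/-! ### Cubes -/

/-- Almost every point of `Oᶜ` is a density point of `Oᶜ`, even along balls that are not centred at
it, provided their distance to it is comparable to their radius. If such a point `x` lay in `s`,
contracting a ball of `interior s` towards `x` would give such balls inside `interior s ⊆ O`, where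
`Oᶜ` has density zero. -/
theorem ae_notMem_of_convex_of_disjoint {d : ℕ} (O : Set (E d)) :
    ∀ᵐ x ∂(volume.restrict Oᶜ), ∀ s : Set (E d), Convex ℝ s → (interior s).Nonempty →
      interior s ⊆ O → x ∉ s := by
  have key : ∀ K : ℕ, ∀ᵐ x ∂(volume.restrict Oᶜ), ∀ (w : ℕ → E d) (δ : ℕ → ℝ),
      Tendsto δ atTop (𝓝[>] 0) → (∀ᶠ j in atTop, x ∈ closedBall (w j) (K * δ j)) →
      Tendsto (fun j => volume (Oᶜ ∩ closedBall (w j) (δ j)) / volume (closedBall (w j) (δ j)))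
        atTop (𝓝 1) := by
    intro K
    filter_upwards [IsUnifLocDoublingMeasure.ae_tendsto_measure_inter_div volume Oᶜ (K : ℝ)]
      with x hx w δ h1 h2 using hx w δ h1 h2
  filter_upwards [ae_all_iff.2 key] with x hx s hs ⟨c, hc⟩ hO hxs
  obtain ⟨r, hr, hball⟩ := nhds_basis_closedBall.mem_iff.1 (isOpen_interior.mem_nhds hc)
  -- The eccentricity is rounded up to a natural number, so that one null set serves for all of the
  -- countably many values.
  obtain ⟨K, hK⟩ := exists_nat_ge (dist x c / r)
  set t : ℕ → ℝ := fun j => 1 / ((j : ℝ) + 1)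
  have ht0 : ∀ j, 0 < t j := fun j => by positivity
  have ht1 : ∀ j, t j ≤ 1 := fun j => by
    simp only [t]
    rw [div_le_one (by positivity)]
    linarith [(Nat.cast_nonneg j : (0 : ℝ) ≤ j)]
  have htl : Tendsto t atTop (𝓝 0) := tendsto_one_div_add_atTop_nhds_zero_nat
  have h := hx K (fun j => x + t j • (c - x)) (fun j => t j * r) ?_ ?_
  · refine absurd (tendsto_nhds_unique h (tendsto_const_nhds.congr fun j => ?_)) one_ne_zero
    have : Oᶜ ∩ closedBall (x + t j • (c - x)) (t j * r) = ∅ := by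
      refine eq_empty_of_forall_notMem fun y ⟨hyO, hy⟩ => hyO (hO ?_)
      set z : E d := c + (t j)⁻¹ • (y - (x + t j • (c - x))) with hz
      have hzb : z ∈ interior s := hball <| by
        rw [mem_closedBall, dist_eq_norm] at hy ⊢
        rw [hz, add_sub_cancel_left, norm_smul, norm_inv, Real.norm_of_nonneg (ht0 j).le,
          inv_mul_le_iff₀ (ht0 j)]
        exact hy
      have hy' : y = (1 - t j) • x + t j • z := by
        rw [hz, smul_add, smul_inv_smul₀ (ht0 j).ne']
        module
      rw [hy']
      exact hs.combo_self_interior_mem_interior hxs hzb (by linarith [ht1 j]) (ht0 j) (by ring)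
    rw [this, measure_empty, ENNReal.zero_div]
  · refine tendsto_nhdsWithin_iff.2 ⟨?_, .of_forall fun j => mul_pos (ht0 j) hr⟩
    simpa using htl.mul_const r
  · refine .of_forall fun j => ?_
    rw [div_le_iff₀ hr] at hK
    rw [mem_closedBall, dist_eq_norm, sub_add_cancel_left, norm_neg, norm_smul,
      Real.norm_of_nonneg (ht0 j).le, ← dist_eq_norm, dist_comm]
    calc t j * dist x c ≤ t j * (K * r) := by gcongr
      _ = _ := by ring

/-- The union of the interiors is open, and what remains is null by the density argument. No
countability is needed. -/
theorem nullMeasurableSet_sUnion_of_convex {d : ℕ} (𝒞 : Set (Set (E d)))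
    (hc : ∀ s ∈ 𝒞, Convex ℝ s) (hi : ∀ s ∈ 𝒞, (interior s).Nonempty) :
    NullMeasurableSet (⋃₀ 𝒞) := by
  set O : Set (E d) := ⋃ s ∈ 𝒞, interior s
  have hO : IsOpen O := isOpen_biUnion fun _ _ => isOpen_interior
  have h0 : volume (⋃₀ 𝒞 \ O) = 0 := by
    have := ae_notMem_of_convex_of_disjoint O
    rw [ae_restrict_iff' hO.measurableSet.compl] at this
    refine measure_mono_null ?_ (ae_iff.1 this)
    rintro x ⟨⟨s, hs, hxs⟩, hxO⟩
    simp only [mem_ofPred_eq, not_forall]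
    exact ⟨hxO, s, hc s hs, hi s hs, subset_biUnion_of_mem (u := fun s => interior s) hs,
      fun h => h hxs⟩
  have hsub : O ⊆ ⋃₀ 𝒞 := iUnion₂_subset fun s hs =>
    interior_subset.trans (subset_sUnion_of_mem hs)
  rw [← union_sdiff_cancel hsub]
  exact hO.measurableSet.nullMeasurableSet.union (NullMeasurableSet.of_null h0)

variable {d : ℕ}

theorem cube_eq_iInter (a : E d) (l : ℝ) :
    cube a l = ⋂ i, (fun x : E d => x i) ⁻¹' Ico (a i) (a i + l) := by
  ext x; simp [cube]

theorem measurableSet_cube (a : E d) (l : ℝ) : MeasurableSet (cube a l) := by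
  rw [cube_eq_iInter]
  refine .iInter fun i => measurableSet_Ico.preimage (by fun_prop)

theorem convex_cube (a : E d) (l : ℝ) : Convex ℝ (cube a l) := by
  rw [cube_eq_iInter]
  exact convex_iInter fun i => (convex_Ico _ _).linear_preimage (EuclideanSpace.proj i).toLinearMap

theorem nonempty_interior_cube (a : E d) {l : ℝ} (hl : 0 < l) : (interior (cube a l)).Nonempty := by
  set U : Set (E d) := ⋂ i, (fun x : E d => x i) ⁻¹' Ioo (a i) (a i + l)
  have hU : IsOpen U := isOpen_iInter_of_finite fun i => isOpen_Ioo.preimage (by fun_prop)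
  have hsub : U ⊆ cube a l := by
    rw [cube_eq_iInter]
    exact iInter_mono fun i => preimage_mono Ioo_subset_Ico_self
  refine ⟨WithLp.toLp 2 fun i => a i + l / 2, interior_maximal hsub hU ?_⟩
  simp only [U, mem_iInter, mem_preimage, mem_Ioo]
  intro i
  constructor <;> linarith

theorem nonempty_cube (a : E d) {l : ℝ} (hl : 0 < l) : (cube a l).Nonempty :=
  (nonempty_interior_cube a hl).mono interior_subset

theorem volume_cube (a : E d) (l : ℝ) : volume (cube a l) = ENNReal.ofReal l ^ d := by
  have h : cube a l = (MeasurableEquiv.toLp 2 (Fin d → ℝ)).symm ⁻¹'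
      (univ.pi fun i => Ico (a i) (a i + l)) := by
    ext x; simp [cube]
  rw [h, (EuclideanSpace.volume_preserving_symm_measurableEquiv_toLp (Fin d)).measure_preimage
    (MeasurableSet.univ_pi fun _ => measurableSet_Ico).nullMeasurableSet, volume_pi_pi]
  simp

theorem volume_cube_ne_top (a : E d) (l : ℝ) : volume (cube a l) ≠ ∞ := by
  rw [volume_cube]; simp

theorem volume_cube_ne_zero (a : E d) {l : ℝ} (hl : 0 < l) : volume (cube a l) ≠ 0 := by
  rw [volume_cube]; simp [hl]

/-- The cube concentric with `cube a l` of five times its side length. -/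
def bigCube (a : E d) (l : ℝ) : Set (E d) :=
  cube (WithLp.toLp 2 fun i => a i - 2 * l) (5 * l)

theorem volume_real_bigCube (a : E d) {l : ℝ} (hl : 0 < l) :
    volume.real (bigCube a l) = 5 ^ d * volume.real (cube a l) := by
  rw [bigCube, measureReal_def, measureReal_def, volume_cube, volume_cube, ENNReal.toReal_pow,
    ENNReal.toReal_pow, ENNReal.toReal_ofReal (by positivity), ENNReal.toReal_ofReal hl.le, mul_pow]

theorem cube_subset_bigCube (a : E d) {l : ℝ} (hl : 0 < l) : cube a l ⊆ bigCube a l := by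
  intro x hx i
  have := hx i
  simp only
  constructor <;> linarith

theorem cube_subset_bigCube_of_inter {a b : E d} {l k : ℝ} (h : (cube a l ∩ cube b k).Nonempty)
    (hlk : l ≤ 2 * k) : cube a l ⊆ bigCube b k := by
  obtain ⟨y, hya, hyb⟩ := h
  intro x hx i
  have := hx i
  have := hya i
  have := hyb i
  simp only
  constructor <;> linarith

theorem exists_countable_disjoint_bigCube (T : Set (E d × ℝ)) (R : ℝ)
    (hT : ∀ q ∈ T, 0 < q.2 ∧ q.2 ≤ R) :
    ∃ S ⊆ T, S.Countable ∧ S.PairwiseDisjoint (fun q => cube q.1 q.2) ∧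
      ⋃ q ∈ T, cube q.1 q.2 ⊆ ⋃ q ∈ S, bigCube q.1 q.2 := by
  -- Selection with ratio 2: a cube at most twice as long that meets the selected one lies within
  -- two side lengths on either side, whence `5 = 1 + 2 * 2`.
  obtain ⟨S, hST, hS, hcov⟩ := Vitali.exists_disjoint_subfamily_covering_enlargement
    (fun q : E d × ℝ => cube q.1 q.2) T (fun q => q.2) 2 one_lt_two (fun q hq => (hT q hq).1.le) R
    (fun q hq => (hT q hq).2) (fun q hq => nonempty_cube _ (hT q hq).1)
  refine ⟨S, hST, hS.countable_of_nonempty_interior fun q hq =>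
    nonempty_interior_cube _ (hT q (hST hq)).1, hS, iUnion₂_subset fun q hq => ?_⟩
  obtain ⟨b, hb, hne, hle⟩ := hcov q hq
  exact (cube_subset_bigCube_of_inter hne hle).trans
    (subset_biUnion_of_mem (u := fun q : E d × ℝ => bigCube q.1 q.2) hb)


/-! ### Duality of Lebesgue spaces -/

section Duality

variable {α : Type*} {mα : MeasurableSpace α} {μ : Measure α}

theorem ae_lt_top_of_eLpNorm_lt_top {p : ℝ≥0∞} (hp : p ≠ 0) {f : α → ℝ≥0∞} (hf : AEMeasurable f μ)
    (h : eLpNorm f p μ < ∞) : ∀ᵐ x ∂μ, f x < ∞ := by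
  rcases eq_or_ne p ∞ with rfl | hp'
  · rw [eLpNorm_exponent_top] at h
    filter_upwards [enorm_ae_le_eLpNormEssSup f μ] with x hx using hx.trans_lt h
  · have hr := ENNReal.toReal_pos hp hp'
    have h1 := (eLpNorm_lt_top_iff_lintegral_rpow_enorm_lt_top (f := f) hp hp').1 h
    filter_upwards [ae_lt_top' (hf.pow_const _) h1.ne] with x hx
    exact (ENNReal.rpow_lt_top_iff_of_pos hr).1 hx

theorem lintegral_mul_lt_top {p q : ℝ≥0∞} (hpq : ENNReal.HolderConjugate p q)
    {f g : α → ℝ≥0∞} (hf : AEMeasurable f μ) (hg : AEMeasurable g μ)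
    (hfp : eLpNorm f p μ < ∞) (hgq : eLpNorm g q μ < ∞) : ∫⁻ x, f x * g x ∂μ < ∞ := by
  have key : ∀ {p : ℝ≥0∞} {f : α → ℝ≥0∞}, AEMeasurable f μ → eLpNorm f p μ < ∞ →
      MemLp (fun x => (f x).toReal) p μ := fun hf h =>
    ⟨hf.ennreal_toReal.aestronglyMeasurable, (eLpNorm_mono_enorm fun x => by
      rw [Real.enorm_of_nonneg ENNReal.toReal_nonneg]
      exact ENNReal.ofReal_toReal_le).trans_lt h⟩
  have h := ((key hg hgq).mul' (key hf hfp) (r := 1)).2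
  rw [eLpNorm_one_eq_lintegral_enorm] at h
  refine (lintegral_congr_ae ?_).trans_lt h
  filter_upwards [ae_lt_top_of_eLpNorm_lt_top hpq.ne_zero hf hfp,
    ae_lt_top_of_eLpNorm_lt_top hpq.symm.ne_zero hg hgq] with x hx hy
  rw [← ENNReal.toReal_mul, Real.enorm_of_nonneg ENNReal.toReal_nonneg,
    ENNReal.ofReal_toReal (ENNReal.mul_lt_top hx hy).ne]

/-- A uniform boundedness principle by condensation: if test functions `f k` in the unit ball pair
with `g` to more than `4 ^ k`, then `(∑ₖ 2⁻ᵏ f k ^ r) ^ (1 / r)` still has finite norm but dominates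
each `2⁻ᵏ f k`, so its pairing with `g` is infinite. -/
theorem exists_forall_lintegral_mul_le {r : ℝ} (hr : 1 ≤ r) {g : α → ℝ≥0∞}
    (h : ∀ f : α → ℝ≥0∞, AEMeasurable f μ → ∫⁻ x, f x ^ r ∂μ < ∞ → ∫⁻ x, f x * g x ∂μ < ∞) :
    ∃ C : ℝ≥0∞, C ≠ ∞ ∧ ∀ f : α → ℝ≥0∞, AEMeasurable f μ → ∫⁻ x, f x ^ r ∂μ ≤ 1 →
      ∫⁻ x, f x * g x ∂μ ≤ C := by
  have hr0 : 0 < r := by linarith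
  by_contra! hC
  choose f hfm hf1 hf using fun k : ℕ => hC (4 ^ k) (by finiteness)
  set F : α → ℝ≥0∞ := fun x => (∑' k, 2⁻¹ ^ k * f k x ^ r) ^ r⁻¹ with hF
  have hFm : AEMeasurable F μ :=
    (AEMeasurable.tsum fun k => ((hfm k).pow_const r).const_mul _).pow_const _
  have hF1 : ∫⁻ x, F x ^ r ∂μ < ∞ := by
    simp only [hF, ENNReal.rpow_inv_rpow hr0.ne']
    rw [lintegral_tsum fun k => ((hfm k).pow_const r).const_mul _]
    calc ∑' k, ∫⁻ x, 2⁻¹ ^ k * f k x ^ r ∂μ ≤ ∑' k : ℕ, (2⁻¹ : ℝ≥0∞) ^ k := by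
          refine ENNReal.tsum_le_tsum fun k => ?_
          rw [lintegral_const_mul'' _ ((hfm k).pow_const r)]
          exact mul_le_of_le_one_right' (hf1 k)
      _ < ∞ := by rw [ENNReal.tsum_geometric]; simp
  refine (h F hFm hF1).ne (ENNReal.eq_top_of_forall_nnreal_le fun C => ?_)
  obtain ⟨k, hk⟩ := pow_unbounded_of_one_lt C (one_lt_two : (1 : ℝ≥0) < 2)
  have hle : ∀ x, 2⁻¹ ^ k * f k x ≤ F x := fun x => by
    rw [hF, ENNReal.le_rpow_inv_iff hr0, ENNReal.mul_rpow_of_nonneg _ _ hr0.le]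
    refine le_trans ?_ (ENNReal.le_tsum k)
    gcongr
    exact ENNReal.rpow_le_self_of_le_one (pow_le_one' (by norm_num) k) hr
  calc (C : ℝ≥0∞) ≤ 2 ^ k := by exact_mod_cast hk.le
    _ = 2⁻¹ ^ k * 4 ^ k := by
      rw [← mul_pow]
      congr 1
      rw [show (4 : ℝ≥0∞) = 2 * 2 by norm_num, ← mul_assoc, ENNReal.inv_mul_cancel (by simp)
        (by simp), one_mul]
    _ ≤ 2⁻¹ ^ k * ∫⁻ x, f k x * g x ∂μ := by gcongr; exact (hf k).le
    _ = ∫⁻ x, 2⁻¹ ^ k * (f k x * g x) ∂μ := by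
      rw [lintegral_const_mul' _ _ (by finiteness)]
    _ ≤ ∫⁻ x, F x * g x ∂μ := by
      refine lintegral_mono fun x => ?_
      rw [← mul_assoc]
      gcongr
      exact hle x

/-- Converse of Hölder's inequality from mere finiteness of the pairings. The test functions are the
constant 1 for `p = ∞`, normalised indicators of superlevel sets for `q = ∞`, and powers of
truncations of `g` otherwise. Finiteness of `μ` makes the truncations integrable. -/
theorem eLpNorm_lt_top_of_forall_lintegral_mul_lt_top [IsFiniteMeasure μ] {p q : ℝ≥0∞}
    (hpq : ENNReal.HolderConjugate p q) {g : α → ℝ≥0∞} (hg : AEMeasurable g μ)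
    (h : ∀ f : α → ℝ≥0∞, AEMeasurable f μ → eLpNorm f p μ < ∞ → ∫⁻ x, f x * g x ∂μ < ∞) :
    eLpNorm g q μ < ∞ := by
  rcases eq_or_ne p ∞ with rfl | hp
  · have hq : q = 1 := by
      have := hpq.inv_add_inv_eq_one
      simpa using this
    subst hq
    rw [eLpNorm_one_eq_lintegral_enorm]
    simpa using h (fun _ => 1) aemeasurable_const (by
      refine (eLpNorm_exponent_top.trans_le (eLpNormEssSup_le_of_ae_enorm_bound (C := 1) ?_)).trans_lt
        ENNReal.one_lt_top
      simp)
  have hp1 : 1 ≤ p := hpq.one_le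
  set r := p.toReal
  have hr1 : 1 ≤ r := by
    rw [← ENNReal.toReal_one]; exact ENNReal.toReal_mono hp hp1
  have hr0 : 0 < r := by linarith
  obtain ⟨C, hC, hfC⟩ := exists_forall_lintegral_mul_le hr1 fun f hf h1 => h f hf <|
    (eLpNorm_lt_top_iff_lintegral_rpow_enorm_lt_top hpq.ne_zero hp).2 h1
  rcases eq_or_ne q ∞ with rfl | hq
  · have hr : r = 1 := by
      have : p = 1 := by simpa using hpq.inv_add_inv_eq_one
      simp [r, this]
    rw [eLpNorm_exponent_top]
    refine (eLpNormEssSup_le_of_ae_enorm_bound (C := C + 1) ?_).trans_lt (by finiteness)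
    rw [ae_iff]
    set s := {x | ¬ ‖g x‖ₑ ≤ C + 1} with hs
    have hsm : NullMeasurableSet s μ := by
      simp only [hs, not_le, enorm_eq_self]
      exact nullMeasurableSet_lt aemeasurable_const hg
    by_contra h0
    have hst : μ s ≠ ∞ := measure_ne_top _ _
    have h1 : ∀ c : ℝ≥0∞, ∀ x, s.indicator (fun _ => c) x * g x = s.indicator (fun x => c * g x) x :=
      fun c x => by by_cases hx : x ∈ s <;> simp [hx]
    have h2 := hfC (s.indicator fun _ => (μ s)⁻¹) (aemeasurable_const.indicator₀ hsm) (by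
      simp only [hr, ENNReal.rpow_one]
      rw [lintegral_indicator_const₀ hsm, ENNReal.inv_mul_cancel h0 hst])
    simp only [h1] at h2
    rw [lintegral_indicator₀ hsm, lintegral_const_mul' _ _ (by simp [h0])] at h2
    have h3 : (C + 1) * μ s ≤ ∫⁻ x in s, g x ∂μ := by
      rw [← setLIntegral_const]
      refine lintegral_mono_ae ?_
      filter_upwards [ae_restrict_mem₀ hsm] with x hx
      exact (not_le.1 hx).le
    have h4 : C + 1 ≤ C := by
      calc C + 1 = (μ s)⁻¹ * ((C + 1) * μ s) := by
            rw [mul_comm (C + 1), ← mul_assoc, ENNReal.inv_mul_cancel h0 hst, one_mul]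
        _ ≤ _ := by gcongr
        _ ≤ C := h2
    exact absurd h4 (not_le.2 (ENNReal.lt_add_right hC one_ne_zero))
  have hrs : r.HolderConjugate q.toReal := hpq.toReal_of_ne_top hp hq
  set s := q.toReal
  have hs0 : 0 < s := hrs.symm.pos
  refine (eLpNorm_lt_top_iff_lintegral_rpow_enorm_lt_top hpq.symm.ne_zero hq).2 ?_
  simp only [enorm_eq_self]
  set G : ℕ → α → ℝ≥0∞ := fun N x => min (g x) N with hG
  have hGm : ∀ N, AEMeasurable (G N) μ := fun N => hg.min aemeasurable_const
  have hsup : ∀ x, ⨆ N, G N x ^ s = g x ^ s := fun x => by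
    refine le_antisymm (iSup_le fun N => by gcongr; exact min_le_left _ _) ?_
    have : Tendsto (fun N : ℕ => G N x ^ s) atTop (𝓝 (g x ^ s)) := by
      refine (ENNReal.continuous_rpow_const.tendsto _).comp ?_
      simpa using (tendsto_const_nhds (x := g x)).min ENNReal.tendsto_nat_nhds_top
    exact le_of_tendsto' this fun N => le_iSup (fun N => G N x ^ s) N
  have hint : ∫⁻ x, g x ^ s ∂μ = ⨆ N, ∫⁻ x, G N x ^ s ∂μ := by
    rw [← lintegral_iSup' (fun N => (hGm N).pow_const s)]
    · simp only [hsup]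
    · refine .of_forall fun x N N' hN => ?_
      simp only [hG]
      gcongr
  have hb : ∫⁻ x, g x ^ s ∂μ ≤ C ^ s := by
    rw [hint]
    refine iSup_le fun N => ?_
    set I := ∫⁻ x, G N x ^ s ∂μ with hI
    rcases eq_or_ne I 0 with hI0 | hI0
    · simp [hI0]
    have hIt : I ≠ ∞ := by
      refine ((lintegral_mono fun x => ?_ :
        I ≤ ∫⁻ _, (N : ℝ≥0∞) ^ s ∂μ).trans_lt ?_).ne
      · simp only [hG]
        gcongr
        exact min_le_right _ _
      · rw [lintegral_const]
        exact ENNReal.mul_lt_top (by finiteness) (measure_lt_top _ _)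
    -- The extremiser of Hölder's inequality for `G N`, normalised by means of `(s - 1) * r = s`.
    -- The pairing is then at least `I ^ (1 / s)`.
    have h1 := hfC (fun x => I ^ (-r⁻¹) * G N x ^ (s - 1)) (((hGm N).pow_const _).const_mul _) (by
      simp only [ENNReal.mul_rpow_of_nonneg _ _ hr0.le, ← ENNReal.rpow_mul]
      rw [lintegral_const_mul'' _ ((hGm N).pow_const _), neg_mul, inv_mul_cancel₀ hr0.ne',
        ENNReal.rpow_neg_one, hrs.symm.sub_one_mul_conj, ENNReal.inv_mul_cancel hI0 hIt])
    have h2 : I ^ s⁻¹ ≤ C := by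
      calc I ^ s⁻¹ = I ^ (-r⁻¹) * I := by
            nth_rw 3 [← ENNReal.rpow_one I]
            rw [← ENNReal.rpow_add _ _ hI0 hIt]
            congr 1
            linarith [hrs.inv_add_inv_eq_one]
        _ = ∫⁻ x, I ^ (-r⁻¹) * G N x ^ s ∂μ := by
            rw [lintegral_const_mul'' _ ((hGm N).pow_const _)]
        _ ≤ _ := by
            refine lintegral_mono fun x => ?_
            rw [mul_assoc]
            gcongr
            calc G N x ^ s = G N x ^ ((s - 1) + 1) := by rw [sub_add_cancel]
              _ = G N x ^ (s - 1) * G N x := by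
                rw [ENNReal.rpow_add_of_nonneg _ _ (by linarith [hrs.symm.lt]) zero_le_one,
                  ENNReal.rpow_one]
              _ ≤ _ := by gcongr; exact min_le_left _ _
        _ ≤ C := h1
    calc I = (I ^ s⁻¹) ^ s := by rw [ENNReal.rpow_inv_rpow hs0.ne']
      _ ≤ _ := by gcongr
  exact hb.trans_lt (by finiteness)

end Duality


/-! ### Bodies and matrix weights -/

section Bodies

variable {𝕜 : Type*} [RCLike 𝕜] {d : ℕ} {V : Type*} [NormedAddCommGroup V] [InnerProductSpace 𝕜 V]

theorem IsBody.zero_mem {K : Set V} (hK : IsBody 𝕜 K) : (0 : V) ∈ K := by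
  obtain ⟨u, hu⟩ := hK.nonempty
  have h := hK.convex u hu ((-1 : 𝕜) • u) (hK.symm u hu (-1) (by simp)) (1 / 2) (by norm_num)
    (by norm_num)
  convert h using 1
  rw [smul_smul, ← add_smul]
  norm_num

theorem zero_mem_bodyHull (S : Set V) : (0 : V) ∈ bodyHull 𝕜 S :=
  mem_sInter.2 fun _ hK => hK.1.zero_mem

theorem subset_bodyHull (S : Set V) : S ⊆ bodyHull 𝕜 S :=
  subset_sInter fun _ hK => hK.2

/-- The closed convex hull of the unimodular orbit of `S` is itself a body, hence contains the
smallest one. The point 0 is adjoined to keep it nonempty when `S` is empty. -/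
theorem exists_mem_convexHull_of_mem_bodyHull [Module ℝ V] [IsScalarTower ℝ 𝕜 V]
    [ContinuousSMul ℝ V] {S : Set V} {u : V} (hu : u ∈ bodyHull 𝕜 S) {δ : ℝ} (hδ : 0 < δ) :
    ∃ v ∈ convexHull ℝ {v : V | v = 0 ∨ ∃ c : 𝕜, ‖c‖ = 1 ∧ ∃ s ∈ S, v = c • s},
      ‖u - v‖ < δ := by
  set T : Set V := {v : V | v = 0 ∨ ∃ c : 𝕜, ‖c‖ = 1 ∧ ∃ s ∈ S, v = c • s} with hT
  have hreal : ∀ (t : ℝ) (v : V), (t : 𝕜) • v = t • v := fun t v => by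
    rw [← algebraMap_smul 𝕜 t v, RCLike.algebraMap_eq_ofReal]
  have hsymm : ∀ c : 𝕜, ‖c‖ = 1 → ∀ v ∈ convexHull ℝ T, c • v ∈ convexHull ℝ T := by
    intro c hc v hv
    have : IsLinearMap ℝ (fun v : V => c • v) :=
      ⟨smul_add c, fun t v => by simp only [← hreal]; rw [smul_comm]⟩
    have h2 : c • v ∈ (fun v : V => c • v) '' convexHull ℝ T := mem_image_of_mem _ hv
    rw [this.image_convexHull] at h2
    refine convexHull_mono ?_ h2
    rintro _ ⟨w, rfl | ⟨e, he, s, hs, rfl⟩, rfl⟩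
    · exact Or.inl (smul_zero c)
    · exact Or.inr ⟨c * e, by simp [hc, he], s, hs, (mul_smul c e s).symm⟩
  have hbody : IsBody 𝕜 (closure (convexHull ℝ T)) := by
    refine ⟨⟨0, subset_closure (subset_convexHull _ _ (Or.inl rfl))⟩, isClosed_closure, ?_, ?_⟩
    · intro u hu v hv t h0 h1
      rw [hreal, hreal]
      exact (convex_convexHull ℝ T).closure hu hv (by linarith) h0 (by ring)
    · intro u hu c hc
      exact map_mem_closure (continuous_const_smul c) hu (hsymm c hc)
  have hS : S ⊆ closure (convexHull ℝ T) := fun s hs =>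
    subset_closure (subset_convexHull _ _ (Or.inr ⟨1, by simp, s, hs, (one_smul _ _).symm⟩))
  obtain ⟨v, hv, hd⟩ := Metric.mem_closure_iff.1 (mem_sInter.1 hu _ ⟨hbody, hS⟩) δ hδ
  exact ⟨v, hv, by rwa [← dist_eq_norm]⟩

/-- The supremum exceeds `c` exactly where `F x` meets the open set `{u | c < ‖u‖ₑ}`. -/
theorem MeasurableSetMap.aemeasurable_iSup {F : E d → Set V} (hF : MeasurableSetMap F) :
    AEMeasurable (fun x => ⨆ u ∈ F x, ‖u‖ₑ) := by
  refine NullMeasurable.aemeasurable ?_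
  refine measurable_of_Ioi (α := ℝ≥0∞) (δ := NullMeasurableSpace (E d) volume) fun c => ?_
  have : (fun x => ⨆ u ∈ F x, ‖u‖ₑ) ⁻¹' Ioi c = {x | (F x ∩ {u | c < ‖u‖ₑ}).Nonempty} := by
    ext x
    simp [lt_iSup_iff, Set.Nonempty]
  have h : NullMeasurableSet {x | (F x ∩ {u | c < ‖u‖ₑ}).Nonempty} :=
    hF _ (isOpen_Ioi.preimage continuous_enorm)
  rw [← this] at h
  exact h

variable (𝕜) in
/-- The set-valued map whose value at `x` is the disk `{c • f x : ‖c‖ ≤ 1}`. -/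
def diskMap (f : E d → V) (x : E d) : Set V :=
  (fun c : 𝕜 => c • f x) '' closedBall 0 1

theorem iSup_diskMap_enorm {V' : Type*} [NormedAddCommGroup V'] [InnerProductSpace 𝕜 V']
    (f : E d → V) (x : E d) (L : V →ₗ[𝕜] V') :
    ⨆ u ∈ diskMap 𝕜 f x, ‖L u‖ₑ = ‖L (f x)‖ₑ := by
  refine le_antisymm (iSup₂_le ?_) ?_
  · rintro _ ⟨c, hc, rfl⟩
    rw [map_smul, enorm_smul]
    refine mul_le_of_le_one_left' ?_
    rw [mem_closedBall_zero_iff] at hc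
    rw [← ofReal_norm]
    exact ENNReal.ofReal_le_one.2 hc
  · exact le_iSup₂_of_le (f x) ⟨1, by simp, one_smul _ _⟩ le_rfl

theorem isBodyMap_diskMap {f : E d → V} (hf : AEStronglyMeasurable f) :
    IsBodyMap 𝕜 (diskMap 𝕜 f) := by
  refine ⟨fun x => ⟨⟨0, 0, by simp, zero_smul _ _⟩, ?_, ?_, ?_⟩, fun U hU => ?_⟩
  · exact ((isCompact_closedBall (0 : 𝕜) 1).image (by fun_prop)).isClosed
  · rintro _ ⟨a, ha, rfl⟩ _ ⟨b, hb, rfl⟩ t h0 h1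
    refine ⟨((1 - t : ℝ) : 𝕜) * a + (t : 𝕜) * b, ?_, by simp [add_smul, mul_smul]⟩
    rw [mem_closedBall_zero_iff] at *
    calc _ ≤ ‖((1 - t : ℝ) : 𝕜) * a‖ + ‖(t : 𝕜) * b‖ := norm_add_le _ _
      _ = (1 - t) * ‖a‖ + t * ‖b‖ := by
        rw [norm_mul, norm_mul, RCLike.norm_ofReal, RCLike.norm_ofReal, abs_of_nonneg h0,
          abs_of_nonneg (by linarith)]
      _ ≤ (1 - t) * 1 + t * 1 := by
        have : 0 ≤ 1 - t := by linarith
        gcongr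
      _ = 1 := by ring
  · rintro _ ⟨a, ha, rfl⟩ c hc
    refine ⟨c * a, ?_, mul_smul _ _ _⟩
    rw [mem_closedBall_zero_iff] at *
    rwa [norm_mul, hc, one_mul]
  -- A countable dense set of scalars in the unit ball suffices to detect whether the disk meets an
  -- open set.
  · obtain ⟨D, hDs, hDc, hD⟩ := TopologicalSpace.IsSeparable.of_separableSpace
      (closedBall (0 : 𝕜) 1) |>.exists_countable_dense_subset
    have : {x | (diskMap 𝕜 f x ∩ U).Nonempty} = ⋃ c ∈ D, {x | c • f x ∈ U} := by
      ext x
      simp only [mem_ofPred_eq, mem_iUnion, exists_prop]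
      constructor
      · rintro ⟨_, ⟨c, hc, rfl⟩, hcU⟩
        obtain ⟨e, he, heD⟩ := mem_closure_iff.1 (hD hc) ((fun c : 𝕜 => c • f x) ⁻¹' U)
          (hU.preimage (by fun_prop)) hcU
        exact ⟨e, heD, he⟩
      · rintro ⟨c, hc, hcU⟩
        exact ⟨_, ⟨c, hDs hc, rfl⟩, hcU⟩
    rw [this]
    refine .biUnion hDc fun c _ => ?_
    borelize V
    exact (hf.const_smul c).aemeasurable.nullMeasurable hU.measurableSet

theorem wBodyNorm_diskMap (p : ℝ≥0∞) (W : E d → V →ₗ[𝕜] V) (f : E d → V) :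
    wBodyNorm p W (diskMap 𝕜 f) = wNorm p W f := by
  refine eLpNorm_congr_enorm_ae (.of_forall fun x => ?_)
  rw [iSup_diskMap_enorm, enorm_eq_self]

theorem MemW.memWBody_diskMap {p : ℝ≥0∞} {W : E d → V →ₗ[𝕜] V} {f : E d → V} (hf : MemW p W f) :
    MemWBody p W (diskMap 𝕜 f) :=
  ⟨isBodyMap_diskMap hf.1, (wBodyNorm_diskMap p W f).trans_lt hf.2⟩

theorem inverse_apply_apply {L : V →L[𝕜] V} (hL : IsUnit L) (u : V) : Ring.inverse L (L u) = u := by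
  have := Ring.inverse_mul_cancel L hL
  exact congrArg (fun A : V →L[𝕜] V => A u) this

theorem apply_inverse_apply {L : V →L[𝕜] V} (hL : IsUnit L) (u : V) : L (Ring.inverse L u) = u := by
  have := Ring.mul_inverse_cancel L hL
  exact congrArg (fun A : V →L[𝕜] V => A u) this

variable [FiniteDimensional 𝕜 V]

theorem IsMatrixWeight.isUnit {W : E d → V →L[𝕜] V} (hW : IsMatrixWeight 𝕜 W) :
    ∀ᵐ x, IsUnit (W x) := by
  have := FiniteDimensional.complete 𝕜 V
  filter_upwards [hW.pos] with x hx
  rw [ContinuousLinearMap.isUnit_iff_bijective]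
  have hinj : Function.Injective (W x : V →ₗ[𝕜] V) := by
    refine (injective_iff_map_eq_zero _).2 fun u hu => ?_
    by_contra hne
    have := hx u hne
    rw [show W x u = 0 from hu] at this
    simp at this
  exact ⟨hinj, LinearMap.injective_iff_surjective.1 hinj⟩

theorem IsMatrixWeight.aestronglyMeasurable_inverse {W : E d → V →L[𝕜] V}
    (hW : IsMatrixWeight 𝕜 W) : AEStronglyMeasurable (fun x => Ring.inverse (W x)) volume := by
  have := FiniteDimensional.complete 𝕜 V
  have hm : Measurable (Ring.inverse : (V →L[𝕜] V) → (V →L[𝕜] V)) := by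
    classical
    set s : Set (V →L[𝕜] V) := {L | IsUnit L}
    have hs : IsOpen s := Units.isOpen
    have heq : (Ring.inverse : (V →L[𝕜] V) → (V →L[𝕜] V)) = s.piecewise Ring.inverse 0 := by
      ext1 L
      by_cases hL : L ∈ s
      · rw [piecewise_eq_of_mem _ _ _ hL]
      · rw [piecewise_eq_of_notMem _ _ _ hL]; exact Ring.inverse_non_unit _ hL
    rw [heq]
    refine ContinuousOn.measurable_piecewise ?_ continuousOn_const hs.measurableSet
    rintro _ ⟨u, rfl⟩
    exact (NormedRing.inverse_continuousAt u).continuousWithinAt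
  have := FiniteDimensional.proper 𝕜 (V →L[𝕜] V)
  exact (hm.comp_aemeasurable hW.measurable.aemeasurable).aestronglyMeasurable

/-- Hölder's inequality applied to `‖u‖ ≤ ‖W⁻¹‖ ‖W u‖`. -/
theorem lintegral_iSup_lt_top_of_memLp_inverse {p : ℝ≥0∞} (hp : 1 ≤ p) {W : E d → V →L[𝕜] V}
    (hW : IsMatrixWeight 𝕜 W) {Q : Set (E d)}
    (hQ : MemLp (fun x => Ring.inverse (W x)) (ENNReal.conjExponent p) (volume.restrict Q))
    {F : E d → Set V} (hF : MemWBody p (fun x => (W x : V →ₗ[𝕜] V)) F) :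
    ∫⁻ x in Q, (⨆ u ∈ F x, ‖u‖ₑ) < ∞ := by
  set N : E d → ℝ≥0∞ := fun x => ‖Ring.inverse (W x)‖ₑ
  set S : E d → ℝ≥0∞ := fun x => ⨆ u ∈ F x, ‖u‖ₑ
  have hS : AEMeasurable S (volume.restrict Q) := hF.1.measurable.aemeasurable_iSup.restrict
  have hN : AEMeasurable N (volume.restrict Q) := hQ.1.enorm
  have hle : ∀ᵐ x ∂(volume.restrict Q), ∀ u, ‖u‖ₑ ≤ N x * ‖W x u‖ₑ := by
    refine ae_restrict_of_ae ?_
    filter_upwards [hW.isUnit] with x hx u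
    calc ‖u‖ₑ = ‖Ring.inverse (W x) (W x u)‖ₑ := by rw [inverse_apply_apply hx]
      _ ≤ _ := ContinuousLinearMap.le_opENorm _ _
  -- The first factor is `N⁻¹ * S`, not the supremum of `‖W x u‖ₑ` that dominates it: measurability
  -- of `S` is already at hand.
  have h := lintegral_mul_lt_top (ENNReal.HolderConjugate.conjExponent hp)
    (hN.inv.mul hS) hN ?_ hQ.2
  · refine (lintegral_mono_ae ?_).trans_lt h
    filter_upwards [hle] with x hx
    have hSx : (⨆ u ∈ F x, ‖u‖ₑ) = S x := rfl
    rw [hSx]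
    rcases eq_or_ne (N x) 0 with h0 | h0
    · have : S x = 0 := by
        simp only [S, ENNReal.iSup_eq_zero]
        intro u _
        simpa [h0] using hx u
      rw [this]; exact zero_le
    · have hNt : N x ≠ ∞ := enorm_ne_top
      simp only [Pi.mul_apply, Pi.inv_apply]
      rw [mul_right_comm, ENNReal.inv_mul_cancel h0 hNt, one_mul]
  · refine lt_of_le_of_lt ?_ hF.2
    refine (eLpNorm_mono_enorm_ae ?_).trans (eLpNorm_mono_measure _ Measure.restrict_le_self)
    filter_upwards [hle] with x hx
    simp only [enorm_eq_self, Pi.mul_apply, Pi.inv_apply]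
    rw [mul_comm, ← ENNReal.div_eq_inv_mul.trans (mul_comm _ _)]
    refine ENNReal.div_le_of_le_mul' (iSup₂_le fun u hu => (hx u).trans ?_)
    gcongr
    exact le_iSup₂_of_le (f := fun u (_ : u ∈ F x) => ‖(W x : V →ₗ[𝕜] V) u‖ₑ) u hu le_rfl

/-- For a scalar `f ∈ L^p(Q)` and a vector `e`, the function `φ = 𝟙_Q f W⁻¹ e` satisfies `W φ = 𝟙_Q
f e`, so its disk map is admissible, and local integrability says that `f ‖W⁻¹ e‖` is integrable on
`Q`. Duality puts `W⁻¹ e` in `L^{p'}(Q)`, and an orthonormal basis of vectors `e` bounds the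
operator norm. -/
theorem memLp_inverse_of_lintegral_iSup_lt_top {p : ℝ≥0∞} (hp : 1 ≤ p) {W : E d → V →L[𝕜] V}
    (hW : IsMatrixWeight 𝕜 W) {Q : Set (E d)} (hQm : MeasurableSet Q) (hQ : volume Q ≠ ∞)
    (h : ∀ F : E d → Set V, MemWBody p (fun x => (W x : V →ₗ[𝕜] V)) F →
      ∫⁻ x in Q, (⨆ u ∈ F x, ‖u‖ₑ) < ∞) :
    MemLp (fun x => Ring.inverse (W x)) (ENNReal.conjExponent p) (volume.restrict Q) := by
  have hfin : IsFiniteMeasure (volume.restrict Q) := ⟨by simpa using hQ.lt_top⟩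
  have hpq := ENNReal.HolderConjugate.conjExponent hp
  have hm := hW.aestronglyMeasurable_inverse
  have hme : ∀ e : V, AEStronglyMeasurable (fun x => Ring.inverse (W x) e) volume := fun e =>
    hm.apply_continuousLinearMap e
  have key : ∀ e : V, MemLp (fun x => Ring.inverse (W x) e) (ENNReal.conjExponent p)
      (volume.restrict Q) := by
    intro e
    refine ⟨(hme e).restrict, ?_⟩
    have := eLpNorm_lt_top_of_forall_lintegral_mul_lt_top hpq
      (g := fun x => ‖Ring.inverse (W x) e‖ₑ) (hme e).restrict.enorm (μ := volume.restrict Q) ?_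
    · simpa only [eLpNorm_enorm] using this
    intro f hf hfp
    set f' : E d → 𝕜 := Q.indicator fun x => ((f x).toReal : 𝕜)
    set φ : E d → V := fun x => f' x • Ring.inverse (W x) e
    have hfm : AEStronglyMeasurable f' volume :=
      (aestronglyMeasurable_indicator_iff hQm).2
        (RCLike.measurable_ofReal.comp_aemeasurable hf.ennreal_toReal).aestronglyMeasurable
    have hmem : MemW p (fun x => (W x : V →ₗ[𝕜] V)) φ := by
      refine ⟨hfm.smul (hme e), ?_⟩
      have h1 : wNorm p (fun x => (W x : V →ₗ[𝕜] V)) φ = eLpNorm (fun x => f' x • e) p volume := by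
        refine eLpNorm_congr_ae ?_
        filter_upwards [hW.isUnit] with x hx
        simp only [φ, map_smul, ContinuousLinearMap.coe_coe, apply_inverse_apply hx]
      have h2 : (fun x => f' x • e) = Q.indicator fun x => ((f x).toReal : 𝕜) • e := by
        ext x; by_cases hx : x ∈ Q <;> simp [f', hx]
      rw [h1, h2, eLpNorm_indicator_eq_eLpNorm_restrict hQm]
      calc eLpNorm (fun x => ((f x).toReal : 𝕜) • e) p (volume.restrict Q)
          ≤ ‖e‖₊ • eLpNorm f p (volume.restrict Q) := by
            refine eLpNorm_le_nnreal_smul_eLpNorm_of_ae_le_mul' (.of_forall fun x => ?_) p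
            rw [enorm_smul, mul_comm, enorm_eq_self]
            gcongr
            · rfl
            · rw [← ofReal_norm, RCLike.norm_ofReal, abs_of_nonneg ENNReal.toReal_nonneg]
              exact ENNReal.ofReal_toReal_le
        _ < ∞ := ENNReal.mul_lt_top (by simp) hfp
    refine (lintegral_congr_ae ?_).trans_lt (h _ hmem.memWBody_diskMap)
    filter_upwards [ae_restrict_mem hQm, ae_lt_top_of_eLpNorm_lt_top hpq.ne_zero hf hfp]
      with x hx hfx
    have := iSup_diskMap_enorm (𝕜 := 𝕜) φ x LinearMap.id
    simp only [LinearMap.id_apply] at this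
    rw [this]
    simp only [φ, f', indicator_of_mem hx, enorm_smul]
    congr 1
    rw [← ofReal_norm, RCLike.norm_ofReal, abs_of_nonneg ENNReal.toReal_nonneg,
      ENNReal.ofReal_toReal hfx.ne]
  set b := stdOrthonormalBasis 𝕜 V
  refine (memLp_finsetSum Finset.univ fun k _ => (key (b k)).norm).mono hm.restrict
    (.of_forall fun x => ?_)
  rw [Real.norm_of_nonneg (Finset.sum_nonneg fun _ _ => norm_nonneg _)]
  refine ContinuousLinearMap.opNorm_le_bound _ (Finset.sum_nonneg fun _ _ => norm_nonneg _)
    fun u => ?_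
  conv_lhs => rw [← b.sum_repr u, map_sum]
  refine (norm_sum_le _ _).trans ?_
  rw [Finset.sum_mul]
  refine Finset.sum_le_sum fun k _ => ?_
  rw [map_smul, norm_smul, mul_comm]
  gcongr
  rw [b.repr_apply_apply]
  simpa using norm_inner_le_norm (𝕜 := 𝕜) (b k) u

end Bodies


/-! ### Averages -/

section Averages

variable {𝕜 : Type*} [RCLike 𝕜] {d : ℕ} {V : Type*} [NormedAddCommGroup V] [InnerProductSpace 𝕜 V]

theorem avg_indicator {Q Q' : Set (E d)} (hQ : MeasurableSet Q) (hsub : Q ⊆ Q')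
    (h0 : volume Q ≠ 0) (ht : volume Q ≠ ∞) (f : E d → V) :
    avg 𝕜 Q' (Q.indicator f) = ((volume.real Q / volume.real Q' : ℝ) : 𝕜) • avg 𝕜 Q f := by
  let _ : NormedSpace ℝ V := NormedSpace.restrictScalars ℝ 𝕜 V
  have hr : ∀ (t : ℝ) (v : V), (t : 𝕜) • v = t • v := fun _ _ => rfl
  have hne : volume.real Q ≠ 0 := (measureReal_ne_zero_iff ht).2 h0
  simp only [avg]
  rw [hr, setAverage_eq, setAverage_eq, setIntegral_indicator hQ, inter_eq_self_of_subset_right hsub,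
    smul_smul]
  congr 1
  field_simp

end Averages

/-! ### Tensor products of matrix weights -/

section Tensor

variable {𝕜 : Type*} [RCLike 𝕜] {d m : ℕ} {H : Fin m → Type*}
  [∀ j, NormedAddCommGroup (H j)] [∀ j, InnerProductSpace 𝕜 (H j)]

theorem tensorMap_injective {L : ∀ j, H j →L[𝕜] H j} (hL : ∀ j, IsUnit (L j)) :
    Function.Injective (tensorMap 𝕜 H L) := by
  refine Function.LeftInverse.injective (g := tensorMap 𝕜 H fun j => Ring.inverse (L j)) fun u => ?_
  change (tensorMap 𝕜 H (fun j => Ring.inverse (L j)) ∘ₗ tensorMap 𝕜 H L) u = u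
  rw [tensorMap, tensorMap]
  have h1 := PiTensorProduct.map_comp (R := 𝕜)
    (fun j => ((Ring.inverse (L j) : H j →L[𝕜] H j) : H j →ₗ[𝕜] H j)) (fun j => (L j : H j →ₗ[𝕜] H j))
  have h2 : (fun j => ((Ring.inverse (L j) : H j →L[𝕜] H j) : H j →ₗ[𝕜] H j) ∘ₗ (L j : H j →ₗ[𝕜] H j)) =
      fun j => LinearMap.id := by
    ext j v
    exact inverse_apply_apply (hL j) v
  rw [h2, PiTensorProduct.map_id] at h1
  exact (LinearMap.congr_fun h1 u).symm

variable [∀ j, FiniteDimensional 𝕜 (H j)]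

instance : FiniteDimensional 𝕜 (HilbertTensor 𝕜 H) := Module.Finite.of_basis (tensorBasis 𝕜 H)

theorem finrank_hilbertTensor :
    Module.finrank 𝕜 (HilbertTensor 𝕜 H) = ∏ j, Module.finrank 𝕜 (H j) := by
  rw [Module.finrank_eq_card_basis (tensorBasis 𝕜 H), Fintype.card_pi]
  simp

theorem continuous_tensor : Continuous (tensor 𝕜 H) := by
  have h : ∀ u, tensor 𝕜 H u =
      ∑ k, (∏ j, inner 𝕜 (stdOrthonormalBasis 𝕜 (H j) (k j)) (u j)) • tensorBasis 𝕜 H k := by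
    intro u
    conv_lhs => rw [← (tensorBasis 𝕜 H).sum_repr (tensor 𝕜 H u)]
    refine Finset.sum_congr rfl fun k _ => ?_
    congr 1
    refine (Basis.piTensorProduct_repr_tprod_apply _ u k).trans ?_
    simp [OrthonormalBasis.coe_toBasis_repr_apply, OrthonormalBasis.repr_apply_apply]
  rw [show ⇑(tensor 𝕜 H) = _ from funext h]
  fun_prop

variable {W : ∀ j, E d → H j →L[𝕜] H j}

theorem aestronglyMeasurable_tensorWeight_apply (hW : ∀ j, AEStronglyMeasurable (W j) volume)
    (u : HilbertTensor 𝕜 H) : AEStronglyMeasurable (fun x => tensorWeight W x u) volume := by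
  refine PiTensorProduct.induction_on
    (motive := fun u : HilbertTensor 𝕜 H =>
      AEStronglyMeasurable (fun x => tensorWeight W x u) volume) u ?_ ?_
  · intro r f
    have h : ∀ x, tensorWeight W x (r • tensor 𝕜 H f) = r • tensor 𝕜 H fun j => W j x (f j) :=
      fun x => by rw [map_smul, tensorWeight, tensorMap_tensor]
    change AEStronglyMeasurable (fun x => tensorWeight W x (r • tensor 𝕜 H f)) volume
    simp only [h]
    have h1 : AEStronglyMeasurable (fun x => tensor 𝕜 H fun j => W j x (f j)) volume := by
      let _ : ∀ j, MeasurableSpace (H j) := fun j => borel (H j)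
      have _ : ∀ j, BorelSpace (H j) := fun j => ⟨rfl⟩
      have _ : ∀ j, ProperSpace (H j) := fun j => FiniteDimensional.proper 𝕜 (H j)
      exact continuous_tensor.comp_aestronglyMeasurable (aemeasurable_pi_iff.2 fun j =>
        ((hW j).apply_continuousLinearMap (f j)).aemeasurable).aestronglyMeasurable
    exact h1.const_smul r
  · intro x y hx hy
    refine (hx.add hy).congr (.of_forall fun z => ?_)
    exact (map_add (tensorWeight W z) x y).symm

theorem ae_tensorWeight_apply_ne_zero (hW : ∀ j, IsMatrixWeight 𝕜 (W j)) {u : HilbertTensor 𝕜 H}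
    (hu : u ≠ 0) : ∀ᵐ x, tensorWeight W x u ≠ 0 := by
  filter_upwards [ae_all_iff.2 fun j => (hW j).isUnit] with x hx
  rw [← map_zero (tensorWeight W x)]
  exact (tensorMap_injective hx).ne hu

/-- An a.e.-measurable majorant of the operator norm of `𝐖`, whose sublevel sets are where `u` can
be perturbed uniformly. -/
theorem exists_norm_tensorWeight_apply_le (hW : ∀ j, AEStronglyMeasurable (W j) volume) :
    ∃ N : E d → ℝ, AEMeasurable N ∧ ∀ x u, ‖tensorWeight W x u‖ ≤ N x * ‖u‖ := by
  set c : (∀ j, Fin (Module.finrank 𝕜 (H j))) → ℝ := fun k =>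
    ‖LinearMap.toContinuousLinearMap ((tensorBasis 𝕜 H).coord k)‖
  refine ⟨fun x => ∑ k, c k * ‖tensorWeight W x (tensorBasis 𝕜 H k)‖, ?_, fun x u => ?_⟩
  · exact Finset.aemeasurable_fun_sum _ fun k _ =>
      (aestronglyMeasurable_tensorWeight_apply hW _).norm.aemeasurable.const_mul _
  · conv_lhs => rw [← (tensorBasis 𝕜 H).sum_repr u, map_sum]
    refine (norm_sum_le _ _).trans ?_
    rw [Finset.sum_mul]
    refine Finset.sum_le_sum fun k _ => ?_
    rw [map_smul, norm_smul, mul_right_comm]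
    gcongr
    exact ContinuousLinearMap.le_opNorm
      (LinearMap.toContinuousLinearMap ((tensorBasis 𝕜 H).coord k)) u

theorem wNorm_indicator {V : Type*} [NormedAddCommGroup V] [InnerProductSpace 𝕜 V]
    (p : ℝ≥0∞) (W : E d → V →ₗ[𝕜] V) {Q : Set (E d)}
    (hQ : MeasurableSet Q) (f : E d → V) :
    wNorm p W (Q.indicator f) = eLpNorm (fun x => W x (f x)) p (volume.restrict Q) := by
  rw [wNorm, ← eLpNorm_indicator_eq_eLpNorm_restrict hQ]
  congr 1
  ext x
  by_cases hx : x ∈ Q <;> simp [hx]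

theorem wNorm_avgOp_le {p : Fin m → ℝ≥0∞} (hfin : muckenhoupt p W < ∞) {Q : Set (E d)}
    (hQ : IsCube Q) {f : ∀ j, E d → H j}
    (hf : ∀ j, MemW (p j) (fun x => (W j x : H j →ₗ[𝕜] H j)) (f j)) :
    wNorm (totalExp p) (tensorWeight W) (avgOp Q f) ≤
      muckenhoupt p W * ∏ j, wNorm (p j) (fun x => (W j x : H j →ₗ[𝕜] H j)) (f j) := by
  have hle : avgOpNorm p W Q ≤ muckenhoupt p W := le_iSup₂_of_le Q hQ le_rfl
  have hlt := hle.trans_lt hfin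
  set b := ∏ j, wNorm (p j) (fun x => (W j x : H j →ₗ[𝕜] H j)) (f j) with hb
  have hbt : b ≠ ∞ := (ENNReal.prod_lt_top fun j _ => (hf j).2).ne
  refine le_trans ?_ (mul_le_mul_left hle b)
  obtain ⟨C, hC, -⟩ := sInf_lt_iff.1 hlt
  -- For `b = 0` division is unavailable, but any single admissible constant already forces the left
  -- side to vanish.
  rcases eq_or_ne b 0 with h0 | h0
  · have := hC f hf
    rw [← hb, h0, mul_zero] at this
    exact this.trans zero_le
  · rw [← ENNReal.div_le_iff h0 hbt]
    exact le_sInf fun C hC => (ENNReal.div_le_iff h0 hbt).2 (hC f hf)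

/-- Cutting the selections off to the small cube divides each average over the big cube by `5 ^ d`,
so the elementary tensor is `5 ^ (d * m)` times the value of `T_{5Q}`. The norms on the right stay
localised to the small cube, which the later summation over disjoint cubes needs. -/
theorem eLpNorm_tensorWeight_tensor_le {p : Fin m → ℝ≥0∞} (hfin : muckenhoupt p W < ∞) {a : E d}
    {l : ℝ} (hl : 0 < l) {F : ∀ j, E d → Set (H j)}
    (hF : ∀ j, MemWBody (p j) (fun x => (W j x : H j →ₗ[𝕜] H j)) (F j)) {u : ∀ j, H j}
    (hu : ∀ j, u j ∈ aumannAvg 𝕜 (cube a l) (F j)) :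
    eLpNorm (fun x => tensorWeight W x (tensor 𝕜 H u)) (totalExp p)
        (volume.restrict (bigCube a l)) ≤
      5 ^ (d * m) * (muckenhoupt p W * ∏ j,
        eLpNorm (fun x => ⨆ v ∈ F j x, ‖(W j x : H j →ₗ[𝕜] H j) v‖ₑ) (p j)
          (volume.restrict (cube a l))) := by
  choose f hfm hfF hfu using hu
  have hQ := measurableSet_cube a l
  set g : ∀ j, E d → H j := fun j => (cube a l).indicator (f j)
  have hg : ∀ j, wNorm (p j) (fun x => (W j x : H j →ₗ[𝕜] H j)) (g j) ≤
      eLpNorm (fun x => ⨆ v ∈ F j x, ‖(W j x : H j →ₗ[𝕜] H j) v‖ₑ) (p j)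
          (volume.restrict (cube a l)) := fun j => by
    rw [wNorm_indicator _ _ hQ]
    refine eLpNorm_mono_enorm_ae ?_
    filter_upwards [hfF j] with x hx
    rw [enorm_eq_self]
    exact le_iSup₂_of_le (f := fun v (_ : v ∈ F j x) => ‖(W j x : H j →ₗ[𝕜] H j) v‖ₑ) _ hx le_rfl
  have hgm : ∀ j, MemW (p j) (fun x => (W j x : H j →ₗ[𝕜] H j)) (g j) := fun j =>
    ⟨(aestronglyMeasurable_indicator_iff hQ).2 (hfm j), (hg j).trans_lt <|
      (eLpNorm_mono_measure _ Measure.restrict_le_self).trans_lt (hF j).2⟩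
  have h := wNorm_avgOp_le hfin (Q := bigCube a l) ⟨_, _, by positivity, rfl⟩ hgm
  set r : 𝕜 := ((volume.real (cube a l) / volume.real (bigCube a l) : ℝ) : 𝕜)
  have hr : (5 : 𝕜) ^ d * r = 1 := by
    have h0 : volume.real (cube a l) ≠ 0 :=
      (measureReal_ne_zero_iff (volume_cube_ne_top a l)).2 (volume_cube_ne_zero a hl)
    have : (5 : ℝ) ^ d * (volume.real (cube a l) / volume.real (bigCube a l)) = 1 := by
      rw [volume_real_bigCube a hl]
      field_simp
    have h2 := congrArg (RCLike.ofReal (K := 𝕜)) this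
    rwa [RCLike.ofReal_mul, RCLike.ofReal_pow, RCLike.ofReal_ofNat, RCLike.ofReal_one] at h2
  have hten : tensor 𝕜 H u = (5 : 𝕜) ^ (d * m) • tensor 𝕜 H fun j => avg 𝕜 (bigCube a l) (g j) := by
    have h1 : (fun j => avg 𝕜 (bigCube a l) (g j)) = fun j => r • u j := by
      ext j
      rw [hfu j]
      exact avg_indicator hQ (cube_subset_bigCube a hl) (volume_cube_ne_zero a hl)
        (volume_cube_ne_top a l) (f j)
    rw [h1, MultilinearMap.map_smul_univ, smul_smul, Finset.prod_const, Finset.card_univ,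
      Fintype.card_fin, pow_mul, ← mul_pow, hr, one_pow, one_smul]
  have h5 : ‖(5 : 𝕜) ^ (d * m)‖ₑ = 5 ^ (d * m) := by
    rw [enorm_pow, ← ofReal_norm, RCLike.norm_ofNat]
    simp
  rw [avgOp, wNorm_indicator _ _ (Q := bigCube a l) (measurableSet_cube _ _)] at h
  rw [hten]
  simp only [map_smul]
  refine (eLpNorm_const_smul_le (c := (5 : 𝕜) ^ (d * m))
    (f := fun x => tensorWeight W x (tensor 𝕜 H fun j => avg 𝕜 (bigCube a l) (g j)))).trans ?_
  rw [h5]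
  gcongr
  refine h.trans ?_
  gcongr with j
  exact hg j

end Tensor


/-! ### The weak-type estimate -/

section LebesgueNorms

variable {α : Type*} {mα : MeasurableSpace α} {μ : Measure α}

theorem eLpNorm_restrict_iUnion_le {V : Type*} [NormedAddCommGroup V] {f : α → V} {q c : ℝ≥0∞}
    {s : ℕ → Set α} (hs : Monotone s) (h : ∀ k, eLpNorm f q (μ.restrict (s k)) ≤ c) :
    eLpNorm f q (μ.restrict (⋃ k, s k)) ≤ c := by
  rcases eq_or_ne q 0 with rfl | h0
  · simp
  rcases eq_or_ne q ∞ with rfl | ht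
  · simp only [eLpNorm_exponent_top] at h ⊢
    refine eLpNormEssSup_le_of_ae_enorm_bound ?_
    rw [ae_restrict_iUnion_iff]
    intro k
    filter_upwards [enorm_ae_le_eLpNormEssSup f (μ.restrict (s k))] with x hx using hx.trans (h k)
  · have hq := ENNReal.toReal_pos h0 ht
    simp only [eLpNorm_eq_lintegral_rpow_enorm_toReal h0 ht, one_div] at h ⊢
    rw [ENNReal.rpow_inv_le_iff hq, setLIntegral_iUnion_of_directed _ hs.directed_le]
    exact iSup_le fun k => (ENNReal.rpow_inv_le_iff hq).1 (h k)

/-- Passing to a measurable hull does not change the restricted measure. The set `s` need not be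
measurable, and it will be `{x | u ∈ M F x}`. -/
theorem eLpNorm_indicator_le_restrict [SFinite μ] {V : Type*} [NormedAddCommGroup V] (f : α → V)
    (q : ℝ≥0∞) (s : Set α) : eLpNorm (s.indicator f) q μ ≤ eLpNorm f q (μ.restrict s) := by
  rw [← Measure.restrict_toMeasurable_of_sFinite s,
    ← eLpNorm_indicator_eq_eLpNorm_restrict (measurableSet_toMeasurable μ s)]
  refine eLpNorm_mono_enorm fun x => ?_
  rw [enorm_indicator_eq_indicator_enorm, enorm_indicator_eq_indicator_enorm]
  exact indicator_le_indicator_of_subset (subset_toMeasurable μ s) (fun _ => zero_le) x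

/-- Carathéodory's theorem gives at most `2 dim V + 1` points, as the real dimension is at most
twice that over `𝕜`. Since `q < 1` is allowed, the triangle inequality in `L^q` is avoided:
pointwise the convex combination is at most the largest term, whose `r`-th power is at most the sum
of the `r`-th powers. The loss is the number of points to the power `1 / q ≤ m`. -/
theorem eLpNorm_apply_le_of_mem_convexHull {𝕜 V : Type*} [RCLike 𝕜] [NormedAddCommGroup V]
    [InnerProductSpace 𝕜 V] [FiniteDimensional 𝕜 V] [Module ℝ V] [IsScalarTower ℝ 𝕜 V]
    {A : α → V →ₗ[𝕜] V} (hA : ∀ u, AEStronglyMeasurable (fun x => A x u) μ) {q : ℝ≥0∞} (hq : q ≠ 0)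
    {m : ℕ} (hqm : q⁻¹ ≤ m) {T : Set V} {B : ℝ≥0∞}
    (hT : ∀ t ∈ T, eLpNorm (fun x => A x t) q μ ≤ B) {u : V} (hu : u ∈ convexHull ℝ T) :
    eLpNorm (fun x => A x u) q μ ≤ (2 * Module.finrank 𝕜 V + 1 : ℕ) ^ m * B := by
  obtain ⟨ι, _, z, w, hz, hind, hw, hw1, rfl⟩ := eq_pos_convex_span_of_mem_convexHull hu
  have hzT : ∀ i, z i ∈ T := fun i => hz (mem_range_self i)
  have hreal : ∀ (t : ℝ) (v : V), t • v = (t : 𝕜) • v := fun t v => by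
    rw [← algebraMap_smul 𝕜 t v, RCLike.algebraMap_eq_ofReal]
  have hcard : Fintype.card ι ≤ 2 * Module.finrank 𝕜 V + 1 := by
    have : Module.Finite ℝ V := Module.Finite.trans 𝕜 V
    refine hind.card_le_finrank_succ.trans (Nat.succ_le_succ ((Submodule.finrank_le _).trans ?_))
    rw [← Module.finrank_mul_finrank ℝ 𝕜 V]
    exact Nat.mul_le_mul_right _ (RCLike.finrank_le_two 𝕜)
  have hsum : ∀ c : ℝ≥0∞, ∑ i, ENNReal.ofReal (w i) * c = c := fun c => by
    rw [← Finset.sum_mul, ← ENNReal.ofReal_sum_of_nonneg fun i _ => (hw i).le, hw1]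
    simp
  have hle : ∀ x c, (∀ i, ‖A x (z i)‖ₑ ≤ c) → ‖A x (∑ i, w i • z i)‖ₑ ≤ c := fun x c hc => by
    rw [map_sum]
    refine (enorm_sum_le _ _).trans ?_
    rw [← hsum c]
    refine Finset.sum_le_sum fun i _ => ?_
    rw [hreal, map_smul, enorm_smul]
    gcongr
    · rw [← ofReal_norm, RCLike.norm_ofReal, abs_of_nonneg (hw i).le]
    · exact hc i
  rcases eq_or_ne q ∞ with rfl | ht
  · refine le_trans ?_ (le_mul_of_one_le_left' (one_le_pow₀ (by simp)))
    simp only [eLpNorm_exponent_top] at hT ⊢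
    refine eLpNormEssSup_le_of_ae_enorm_bound ?_
    have := ae_all_iff.2 fun i => enorm_ae_le_eLpNormEssSup (fun x => A x (z i)) μ
    filter_upwards [this] with x hx
    exact hle x B fun i => (hx i).trans (hT _ (hzT i))
  · have hr := ENNReal.toReal_pos hq ht
    set r := q.toReal
    simp only [eLpNorm_eq_lintegral_rpow_enorm_toReal hq ht, one_div] at hT ⊢
    have h1 : ∫⁻ x, ‖A x (∑ i, w i • z i)‖ₑ ^ r ∂μ ≤ ∑ i, ∫⁻ x, ‖A x (z i)‖ₑ ^ r ∂μ := by
      rw [← lintegral_finsetSum' _ fun i _ => (hA (z i)).enorm.pow_const r]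
      refine lintegral_mono fun x => (ENNReal.le_rpow_inv_iff hr).1 (hle x _ fun i => ?_)
      rw [ENNReal.le_rpow_inv_iff hr]
      exact Finset.single_le_sum (f := fun i => ‖A x (z i)‖ₑ ^ r) (fun _ _ => zero_le)
        (Finset.mem_univ i)
    have h2 : ∑ i, ∫⁻ x, ‖A x (z i)‖ₑ ^ r ∂μ ≤ (2 * Module.finrank 𝕜 V + 1 : ℕ) * B ^ r := by
      refine (Finset.sum_le_card_nsmul _ _ (B ^ r) fun i _ =>
        (ENNReal.rpow_inv_le_iff hr).1 (hT _ (hzT i))).trans ?_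
      rw [nsmul_eq_mul, Finset.card_univ]
      gcongr
    refine (ENNReal.rpow_le_rpow (h1.trans h2) (by positivity)).trans ?_
    rw [ENNReal.mul_rpow_of_nonneg _ _ (by positivity), ENNReal.rpow_rpow_inv hr.ne']
    gcongr
    rw [← ENNReal.rpow_natCast]
    refine ENNReal.rpow_le_rpow_of_exponent_le (by simp) ?_
    have := ENNReal.toReal_mono (by simp) hqm
    rwa [ENNReal.toReal_inv, ENNReal.toReal_natCast] at this

theorem totalExp_ne_zero {m : ℕ} {p : Fin m → ℝ≥0∞} (hp : ∀ j, 1 ≤ p j) : totalExp p ≠ 0 := by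
  rw [totalExp, Ne, ENNReal.inv_eq_zero, ← Ne]
  exact (ENNReal.sum_lt_top.2 fun j _ =>
    (ENNReal.inv_le_one.2 (hp j)).trans_lt ENNReal.one_lt_top).ne

theorem inv_totalExp_le {m : ℕ} {p : Fin m → ℝ≥0∞} (hp : ∀ j, 1 ≤ p j) : (totalExp p)⁻¹ ≤ m := by
  rw [totalExp, inv_inv]
  simpa using Finset.sum_le_sum fun j (_ : j ∈ Finset.univ) => ENNReal.inv_le_one.2 (hp j)

theorem sum_totalExp_div {m : ℕ} {p : Fin m → ℝ≥0∞} (hp : ∀ j, 1 ≤ p j) (ht : totalExp p ≠ ∞) :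
    ∑ j, (totalExp p).toReal / (p j).toReal = 1 := by
  have h0 := ENNReal.toReal_pos (totalExp_ne_zero hp) ht
  have h1 : ((totalExp p).toReal)⁻¹ = ∑ j, ((p j).toReal)⁻¹ := by
    rw [← ENNReal.toReal_inv, totalExp, inv_inv, ENNReal.toReal_sum fun j _ =>
      ((ENNReal.inv_le_one.2 (hp j)).trans_lt ENNReal.one_lt_top).ne]
    simp only [ENNReal.toReal_inv]
  simp only [div_eq_mul_inv]
  rw [← Finset.mul_sum, ← h1, mul_inv_cancel₀ h0.ne']

/-- Hölder's inequality for the counting measure with the exponents `p / pⱼ`, which add up to one,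
combined with additivity of the integrals over disjoint sets. -/
theorem tsum_prod_eLpNorm_restrict_le {ι : Type*} [Countable ι] {Q : ι → Set α}
    (hQ : ∀ i, MeasurableSet (Q i)) (hd : Pairwise (Function.onFun Disjoint Q)) {m : ℕ}
    {p : Fin m → ℝ≥0∞} (hp : ∀ j, 1 ≤ p j) (ht : totalExp p ≠ ∞) (φ : Fin m → α → ℝ≥0∞) :
    ∑' i, (∏ j, eLpNorm (φ j) (p j) (μ.restrict (Q i))) ^ (totalExp p).toReal ≤
      (∏ j, eLpNorm (φ j) (p j) μ) ^ (totalExp p).toReal := by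
  classical
  set r := (totalExp p).toReal
  have hr : 0 < r := ENNReal.toReal_pos (totalExp_ne_zero hp) ht
  set s : Fin m → ℝ := fun j => r / (p j).toReal
  have hs1 : ∑ j, s j = 1 := sum_totalExp_div hp ht
  have hs0 : ∀ j, 0 ≤ s j := fun j => div_nonneg hr.le ENNReal.toReal_nonneg
  set b : Fin m → ι → ℝ≥0∞ := fun j i => ∫⁻ x in Q i, φ j x ^ (p j).toReal ∂μ
  -- An index with `p j = ∞` has `s j = 0`, because `∞.toReal = 0` and division by zero gives zero.
  -- Its factor is bounded by the global norm and kept in `K j`.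
  set K : Fin m → ℝ≥0∞ := fun j => if p j = ∞ then eLpNorm (φ j) (p j) μ ^ r else 1
  have hp0 : ∀ j, p j ≠ 0 := fun j => (zero_lt_one.trans_le (hp j)).ne'
  have hpow : ∀ j, p j ≠ ∞ → ∀ ν : Measure α, eLpNorm (φ j) (p j) ν ^ r =
      (∫⁻ x, φ j x ^ (p j).toReal ∂ν) ^ s j := fun j hj ν => by
    rw [eLpNorm_eq_lintegral_rpow_enorm_toReal (hp0 j) hj, ← ENNReal.rpow_mul, one_div_mul_eq_div]
    simp only [enorm_eq_self]
    rfl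
  have h1 : ∀ j i, eLpNorm (φ j) (p j) (μ.restrict (Q i)) ^ r ≤ K j * b j i ^ s j := by
    intro j i
    by_cases hj : p j = ∞
    · have hsj : s j = 0 := by simp [s, hj]
      simp only [K, if_pos hj, hsj, ENNReal.rpow_zero, mul_one]
      gcongr
      exact Measure.restrict_le_self
    · simp only [K, if_neg hj, one_mul]
      exact (hpow j hj _).le
  have h2 : ∀ j, K j * (∑' i, b j i) ^ s j ≤ eLpNorm (φ j) (p j) μ ^ r := by
    intro j
    by_cases hj : p j = ∞
    · have hsj : s j = 0 := by simp [s, hj]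
      simp [K, if_pos hj, hsj]
    · simp only [K, if_neg hj, one_mul]
      rw [hpow j hj]
      gcongr
      rw [← lintegral_iUnion hQ hd]
      exact lintegral_mono' Measure.restrict_le_self le_rfl
  let _ : MeasurableSpace ι := ⊤
  have h3 : ∑' i, ∏ j, b j i ^ s j ≤ ∏ j, (∑' i, b j i) ^ s j := by
    have := ENNReal.lintegral_prod_norm_pow_le (μ := Measure.count) Finset.univ (f := b)
      (fun j _ => (measurable_from_top (f := b j)).aemeasurable) hs1 fun j _ => hs0 j
    simpa only [lintegral_count] using this
  calc ∑' i, (∏ j, eLpNorm (φ j) (p j) (μ.restrict (Q i))) ^ r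
      ≤ ∑' i, (∏ j, K j) * ∏ j, b j i ^ s j := by
        refine ENNReal.tsum_le_tsum fun i => ?_
        rw [← ENNReal.prod_rpow_of_nonneg hr.le, ← Finset.prod_mul_distrib]
        exact Finset.prod_le_prod' fun j _ => h1 j i
    _ = (∏ j, K j) * ∑' i, ∏ j, b j i ^ s j := ENNReal.tsum_mul_left
    _ ≤ (∏ j, K j) * ∏ j, (∑' i, b j i) ^ s j := by gcongr
    _ ≤ _ := by
        rw [← ENNReal.prod_rpow_of_nonneg hr.le, ← Finset.prod_mul_distrib]
        exact Finset.prod_le_prod' fun j _ => h2 j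

end LebesgueNorms

/-! ### Vitali covering and summation of the local estimates -/

section Covering

variable {d m : ℕ}

theorem eLpNorm_restrict_biUnion_cube_le {V : Type*} [NormedAddCommGroup V] {f : E d → V}
    {p : Fin m → ℝ≥0∞} (hp : ∀ j, 1 ≤ p j) (φ : Fin m → E d → ℝ≥0∞) {K : ℝ≥0∞} {G : Set (E d)}
    {T : Set (E d × ℝ)} (hT0 : ∀ q ∈ T, 0 < q.2)
    (hT : ∀ q ∈ T, eLpNorm f (totalExp p) (volume.restrict (bigCube q.1 q.2 ∩ G)) ≤
      K * ∏ j, eLpNorm (φ j) (p j) (volume.restrict (cube q.1 q.2))) :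
    eLpNorm f (totalExp p) (volume.restrict ((⋃ q ∈ T, cube q.1 q.2) ∩ G)) ≤
      K * ∏ j, eLpNorm (φ j) (p j) volume := by
  -- Vitali's lemma needs bounded side lengths. The bound for each `R` does not depend on `R`, so
  -- the union over `R` inherits it.
  set U : ℕ → Set (E d) := fun R => (⋃ q ∈ {q ∈ T | q.2 ≤ R}, cube q.1 q.2) ∩ G
  have hU : Monotone U := fun R R' hR => inter_subset_inter_left _ <|
    biUnion_subset_biUnion_left fun q hq => ⟨hq.1, hq.2.trans (Nat.cast_le.2 hR)⟩
  have hUT : (⋃ q ∈ T, cube q.1 q.2) ∩ G = ⋃ R, U R := by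
    rw [← iUnion_inter]
    congr 1
    ext x
    simp only [mem_iUnion, exists_prop]
    constructor
    · rintro ⟨q, hq, hx⟩
      obtain ⟨R, hR⟩ := exists_nat_ge q.2
      exact ⟨R, q, ⟨hq, hR⟩, hx⟩
    · rintro ⟨R, q, hq, hx⟩
      exact ⟨q, hq.1, hx⟩
  rw [hUT]
  refine eLpNorm_restrict_iUnion_le hU fun R => ?_
  obtain ⟨S, hST, hSc, hSd, hcov⟩ := exists_countable_disjoint_bigCube {q ∈ T | q.2 ≤ R} R
    fun q hq => ⟨hT0 q hq.1, hq.2⟩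
  have := hSc.to_subtype
  have hsub : U R ⊆ ⋃ q : S, bigCube q.1.1 q.1.2 ∩ G := by
    rw [← iUnion_inter, iUnion_subtype]
    exact inter_subset_inter_left _ hcov
  refine (eLpNorm_mono_measure f (Measure.restrict_mono hsub le_rfl)).trans ?_
  rcases eq_or_ne (totalExp p) ∞ with ht | ht
  · rw [ht] at hT ⊢
    simp only [eLpNorm_exponent_top] at hT ⊢
    refine eLpNormEssSup_le_of_ae_enorm_bound ?_
    rw [ae_restrict_iUnion_iff]
    intro q
    filter_upwards [enorm_ae_le_eLpNormEssSup f
      (volume.restrict (bigCube q.1.1 q.1.2 ∩ G))] with x hx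
    refine (hx.trans (hT q (hST q.2).1)).trans ?_
    gcongr with j
    exact Measure.restrict_le_self
  · have h0 := totalExp_ne_zero hp
    have hr := ENNReal.toReal_pos h0 ht
    have hsum := tsum_prod_eLpNorm_restrict_le (μ := volume) (Q := fun q : S => cube q.1.1 q.1.2)
      (fun q => measurableSet_cube _ _)
      ((pairwise_subtype_iff_pairwise_set S _).2 hSd) hp ht φ
    simp only [eLpNorm_eq_lintegral_rpow_enorm_toReal h0 ht, one_div] at hT ⊢
    rw [ENNReal.rpow_inv_le_iff hr]
    refine (lintegral_iUnion_le _ _).trans ?_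
    refine (ENNReal.tsum_le_tsum fun q : S =>
      (ENNReal.rpow_inv_le_iff hr).1 (hT q (hST q.2).1)).trans ?_
    simp only [ENNReal.mul_rpow_of_nonneg _ _ hr.le]
    rw [ENNReal.tsum_mul_left]
    gcongr

end Covering


/-! ### The maximal operator -/

section Maximal

variable {𝕜 : Type*} [RCLike 𝕜] {d m : ℕ} {H : Fin m → Type*}
  [∀ j, NormedAddCommGroup (H j)] [∀ j, InnerProductSpace 𝕜 (H j)]
  [∀ j, FiniteDimensional 𝕜 (H j)] {W : ∀ j, E d → H j →L[𝕜] H j}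

/-- The set `⨂ⱼ ⟨Fⱼ⟩_Q` of elementary tensors of averages. -/
def tensorAvg (F : ∀ j, E d → Set (H j)) (Q : Set (E d)) : Set (HilbertTensor 𝕜 H) :=
  {w | ∃ u : ∀ j, H j, (∀ j, u j ∈ aumannAvg 𝕜 Q (F j)) ∧ w = tensor 𝕜 H u}

theorem exists_of_mem_maximalOp {F : ∀ j, E d → Set (H j)} {x : E d} {u : HilbertTensor 𝕜 H}
    (hu : u ∈ maximalOp F x) (hu0 : u ≠ 0) {δ : ℝ} (hδ : 0 < δ) :
    ∃ (a : E d) (l : ℝ), 0 < l ∧ x ∈ cube a l ∧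
      ∃ w ∈ bodyHull 𝕜 (tensorAvg F (cube a l)), ‖u - w‖ < δ := by
  -- A cube that misses `x` contributes only the vector 0, which is at distance `‖u‖` from `u` and
  -- so is excluded.
  obtain ⟨y, hy, hd⟩ := Metric.mem_closure_iff.1 hu (min δ ‖u‖) (lt_min hδ (norm_pos_iff.2 hu0))
  obtain ⟨Q, hQ, w, hw, rfl⟩ := mem_iUnion₂.1 hy
  obtain ⟨a, l, hl, rfl⟩ := hQ
  rw [dist_eq_norm] at hd
  by_cases hx : x ∈ cube a l
  · simp only [indicator_of_mem hx] at hd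
    exact ⟨a, l, hl, hx, w, hw, hd.trans_le (min_le_left _ _)⟩
  · simp only [indicator_of_notMem hx, sub_zero] at hd
    exact absurd (hd.trans_le (min_le_right _ _)) (lt_irrefl _)

/-- An open set that contains 0 is met everywhere. Any other is met exactly on the union of the
cubes whose body hull meets it, as the closure does not affect meeting an open set. -/
theorem measurableSetMap_maximalOp (F : ∀ j, E d → Set (H j)) :
    MeasurableSetMap (maximalOp (𝕜 := 𝕜) F) := by
  intro U hU
  have hmem : ∀ (Q : Set (E d)) (x : E d) (y : HilbertTensor 𝕜 H), IsCube Q →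
      y ∈ (fun w => Q.indicator (fun _ => w) x) '' bodyHull 𝕜 (tensorAvg F Q) →
      y ∈ ⋃ (Q : Set (E d)) (_ : IsCube Q),
        (fun w => Q.indicator (fun _ => w) x) '' bodyHull 𝕜 (tensorAvg F Q) :=
    fun Q x y hQ hy => mem_iUnion₂.2 ⟨Q, hQ, hy⟩
  by_cases h0 : (0 : HilbertTensor 𝕜 H) ∈ U
  · convert MeasurableSet.univ.nullMeasurableSet
    refine eq_univ_of_forall fun x => ⟨0, subset_closure ?_, h0⟩
    refine hmem (cube 0 1) x 0 ⟨0, 1, one_pos, rfl⟩ ⟨0, zero_mem_bodyHull _, ?_⟩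
    simp
  · have : {x | (maximalOp (𝕜 := 𝕜) F x ∩ U).Nonempty} =
        ⋃₀ {Q | IsCube Q ∧ (bodyHull 𝕜 (tensorAvg F Q) ∩ U).Nonempty} := by
      ext x
      rw [mem_ofPred_eq, maximalOp, closure_inter_open_nonempty_iff hU]
      constructor
      · rintro ⟨y, hy, hyU⟩
        obtain ⟨Q, hQ, w, hw, rfl⟩ := mem_iUnion₂.1 hy
        by_cases hx : x ∈ Q
        · simp only [indicator_of_mem hx] at hyU
          exact ⟨Q, ⟨hQ, w, hw, hyU⟩, hx⟩
        · simp only [indicator_of_notMem hx] at hyU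
          exact absurd hyU h0
      · rintro ⟨Q, ⟨hQ, w, hw, hwU⟩, hx⟩
        exact ⟨w, hmem Q x w hQ ⟨w, hw, by simp [hx]⟩, hwU⟩
    rw [this]
    refine nullMeasurableSet_sUnion_of_convex _ ?_ ?_
    · rintro _ ⟨⟨a, l, hl, rfl⟩, -⟩
      exact convex_cube a l
    · rintro _ ⟨⟨a, l, hl, rfl⟩, -⟩
      exact nonempty_interior_cube a hl

theorem eLpNorm_tensorWeight_convexHull_le {p : Fin m → ℝ≥0∞} (hp : ∀ j, 1 ≤ p j)
    (hW : ∀ j, IsMatrixWeight 𝕜 (W j)) (hfin : muckenhoupt p W < ∞) {a : E d} {l : ℝ} (hl : 0 < l)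
    {F : ∀ j, E d → Set (H j)} (hF : ∀ j, MemWBody (p j) (fun x => (W j x : H j →ₗ[𝕜] H j)) (F j))
    [Module ℝ (HilbertTensor 𝕜 H)] [IsScalarTower ℝ 𝕜 (HilbertTensor 𝕜 H)]
    {v : HilbertTensor 𝕜 H}
    (hv : v ∈ convexHull ℝ {v : HilbertTensor 𝕜 H |
      v = 0 ∨ ∃ c : 𝕜, ‖c‖ = 1 ∧ ∃ s ∈ tensorAvg F (cube a l), v = c • s}) :
    eLpNorm (fun x => tensorWeight W x v) (totalExp p) (volume.restrict (bigCube a l)) ≤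
      (2 * ∏ j, Module.finrank 𝕜 (H j) + 1 : ℕ) ^ m * (5 ^ (d * m) * (muckenhoupt p W * ∏ j,
        eLpNorm (fun x => ⨆ v ∈ F j x, ‖(W j x : H j →ₗ[𝕜] H j) v‖ₑ) (p j)
          (volume.restrict (cube a l)))) := by
  rw [← finrank_hilbertTensor]
  refine eLpNorm_apply_le_of_mem_convexHull
    (fun u => (aestronglyMeasurable_tensorWeight_apply (fun j => (hW j).measurable) u).restrict)
    (totalExp_ne_zero hp) (inv_totalExp_le hp) ?_ hv
  rintro _ (rfl | ⟨c, hc, _, ⟨u, hu, rfl⟩, rfl⟩)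
  · simp
  · refine le_trans (eLpNorm_mono_enorm fun x => ?_) (eLpNorm_tensorWeight_tensor_le hfin hl hF hu)
    rw [map_smul, enorm_smul, ← ofReal_norm, hc]
    simp

/-- The values of `M` are closures, so `u` is only approximated by vectors that come from cubes. The
sets `G k` exhaust the space up to a null set, and on each of them the approximation is uniform
enough to compare `𝐖 u` with `𝐖 v`. -/
theorem wNorm_indicator_maximalOp_le {p : Fin m → ℝ≥0∞} (hp : ∀ j, 1 ≤ p j)
    (hW : ∀ j, IsMatrixWeight 𝕜 (W j)) (hfin : muckenhoupt p W < ∞) {F : ∀ j, E d → Set (H j)}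
    (hF : ∀ j, MemWBody (p j) (fun x => (W j x : H j →ₗ[𝕜] H j)) (F j))
    {u : HilbertTensor 𝕜 H} (hu0 : u ≠ 0) :
    wNorm (totalExp p) (tensorWeight W) ({x | u ∈ maximalOp F x}.indicator fun _ => u) ≤
      2 * ((2 * ∏ j, Module.finrank 𝕜 (H j) + 1 : ℕ) ^ m * (5 ^ (d * m) * muckenhoupt p W)) *
        ∏ j, wBodyNorm (p j) (fun x => (W j x : H j →ₗ[𝕜] H j)) (F j) := by
  set A := {x | u ∈ maximalOp F x} with hA
  set f : E d → HilbertTensor 𝕜 H := fun x => tensorWeight W x u with hf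
  have hfm : AEStronglyMeasurable f volume :=
    aestronglyMeasurable_tensorWeight_apply (fun j => (hW j).measurable) u
  obtain ⟨N, hNm, hN⟩ := exists_norm_tensorWeight_apply_le fun j => (hW j).measurable
  set G : ℕ → Set (E d) := fun k => {x | N x ≤ k + 1} ∩ {x | ((k : ℝ) + 1)⁻¹ ≤ ‖f x‖} with hG
  have hGm : ∀ k, NullMeasurableSet (G k) := fun k =>
    (nullMeasurableSet_le hNm aemeasurable_const).inter
      (nullMeasurableSet_le aemeasurable_const hfm.norm.aemeasurable)
  have hGmono : Monotone fun k => A ∩ G k := fun k k' hk => by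
    have hk' : (k : ℝ) ≤ k' := Nat.cast_le.2 hk
    refine inter_subset_inter_right _ fun x ⟨h1, h2⟩ => ⟨?_, ?_⟩
    · have h3 : N x ≤ k + 1 := h1
      exact h3.trans (by linarith)
    · have h3 : ((k : ℝ) + 1)⁻¹ ≤ ‖f x‖ := h2
      exact (inv_anti₀ (by positivity) (by linarith) : ((k' : ℝ) + 1)⁻¹ ≤ ((k : ℝ) + 1)⁻¹).trans h3
  have hAG : A ≤ᵐ[volume] ⋃ k, A ∩ G k := by
    filter_upwards [ae_tensorWeight_apply_ne_zero hW hu0] with x hx hxA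
    obtain ⟨k, hk⟩ := exists_nat_ge (max (N x) ‖f x‖⁻¹)
    refine mem_iUnion.2 ⟨k, hxA, ?_, ?_⟩
    · exact ((le_max_left _ _).trans hk).trans (by linarith)
    · exact inv_le_of_inv_le₀ (norm_pos_iff.2 hx) (((le_max_right _ _).trans hk).trans (by linarith))
  have hind : wNorm (totalExp p) (tensorWeight W) (A.indicator fun _ => u) =
      eLpNorm (A.indicator f) (totalExp p) volume := by
    rw [wNorm]
    congr 1
    ext1 x
    by_cases hx : x ∈ A <;> simp [hx, hf]
  rw [hind]
  refine (eLpNorm_indicator_le_restrict _ _ _).trans ?_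
  refine (eLpNorm_mono_measure _ (Measure.restrict_mono_ae hAG)).trans ?_
  refine eLpNorm_restrict_iUnion_le hGmono fun k => ?_
  -- On `G k` this makes `‖𝐖 (u - v)‖ ≤ (k + 1) δ = (k + 1)⁻¹ / 2`, at most half of `‖𝐖 u‖`. Hence
  -- `‖𝐖 u‖ ≤ 2 ‖𝐖 v‖`. The error `δ` is shared equally between the steps from `u` to `w` and from
  -- `w` to `v`.
  set δ : ℝ := ((k : ℝ) + 1)⁻¹ ^ 2 / 2 with hδ
  have hδ0 : 0 < δ := by positivity
  set T : Set (E d × ℝ) :=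
    {q | 0 < q.2 ∧ ∃ w ∈ bodyHull 𝕜 (tensorAvg F (cube q.1 q.2)), ‖u - w‖ < δ / 2}
  have hsub : A ∩ G k ⊆ (⋃ q ∈ T, cube q.1 q.2) ∩ G k := by
    refine inter_subset_inter_left _ fun x hx => ?_
    obtain ⟨a, l, hl, hxa, hw⟩ := exists_of_mem_maximalOp hx hu0 (half_pos hδ0)
    exact mem_iUnion₂.2 ⟨(a, l), ⟨hl, hw⟩, hxa⟩
  refine (eLpNorm_mono_measure _ (Measure.restrict_mono hsub le_rfl)).trans ?_
  refine eLpNorm_restrict_biUnion_cube_le hp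
    (fun j x => ⨆ v ∈ F j x, ‖(W j x : H j →ₗ[𝕜] H j) v‖ₑ) (fun q hq => hq.1) ?_
  rintro ⟨a, l⟩ ⟨hl, w, hw, huw⟩
  let _ : NormedSpace ℝ (HilbertTensor 𝕜 H) := NormedSpace.restrictScalars ℝ 𝕜 _
  have _ : IsScalarTower ℝ 𝕜 (HilbertTensor 𝕜 H) := .of_algebraMap_smul fun _ _ => rfl
  obtain ⟨v, hv, hwv⟩ := exists_mem_convexHull_of_mem_bodyHull hw (half_pos hδ0)
  have huv : ‖u - v‖ ≤ δ := by
    calc ‖u - v‖ ≤ ‖u - w‖ + ‖w - v‖ := norm_sub_le_norm_sub_add_norm_sub _ _ _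
      _ ≤ δ := by linarith
  have hle : ∀ x ∈ G k, ‖f x‖ ≤ 2 * ‖tensorWeight W x v‖ := by
    rintro x ⟨h1, h2⟩
    have h3 : ‖f x - tensorWeight W x v‖ ≤ ((k : ℝ) + 1)⁻¹ / 2 := by
      rw [hf, ← map_sub]
      calc _ ≤ N x * ‖u - v‖ := hN _ _
        _ ≤ (k + 1) * δ := by
          have : N x ≤ k + 1 := h1
          gcongr
        _ = _ := by rw [hδ]; field_simp
    have h4 := norm_sub_norm_le (f x) (tensorWeight W x v)
    have h5 : ((k : ℝ) + 1)⁻¹ ≤ ‖f x‖ := h2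
    linarith
  have hcube := eLpNorm_tensorWeight_convexHull_le hp hW hfin hl hF hv
  calc eLpNorm f (totalExp p) (volume.restrict (bigCube a l ∩ G k))
      ≤ (2 : ℝ≥0) • eLpNorm (fun x => tensorWeight W x v) (totalExp p)
          (volume.restrict (bigCube a l ∩ G k)) := by
        refine eLpNorm_le_nnreal_smul_eLpNorm_of_ae_le_mul ?_ _
        have hm : NullMeasurableSet (bigCube a l ∩ G k) :=
          (measurableSet_cube _ _).nullMeasurableSet.inter (hGm k)
        filter_upwards [ae_restrict_mem₀ hm] with x hx
        exact_mod_cast hle x hx.2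
    _ ≤ 2 * eLpNorm (fun x => tensorWeight W x v) (totalExp p)
          (volume.restrict (bigCube a l)) := by
        rw [ENNReal.smul_def, smul_eq_mul]
        gcongr
        · norm_num
        · exact inter_subset_left
    _ ≤ _ := by
        refine (mul_le_mul_right hcube 2).trans_eq ?_
        simp only [mul_assoc]

theorem weakNorm_maximalOp_le {p : Fin m → ℝ≥0∞} (hp : ∀ j, 1 ≤ p j)
    (hW : ∀ j, IsMatrixWeight 𝕜 (W j)) (hfin : muckenhoupt p W < ∞) {F : ∀ j, E d → Set (H j)}
    (hF : ∀ j, MemWBody (p j) (fun x => (W j x : H j →ₗ[𝕜] H j)) (F j)) :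
    weakNorm (totalExp p) (tensorWeight W) (maximalOp F) ≤
      2 * ((2 * ∏ j, Module.finrank 𝕜 (H j) + 1 : ℕ) ^ m * (5 ^ (d * m) * muckenhoupt p W)) *
        ∏ j, wBodyNorm (p j) (fun x => (W j x : H j →ₗ[𝕜] H j)) (F j) := by
  refine iSup_le fun u => ?_
  rcases eq_or_ne u 0 with rfl | hu0
  · simp [wNorm]
  · exact wNorm_indicator_maximalOp_le hp hW hfin hF hu0

/-- On the disk maps of `f` the weighted norms agree with those of `f`, and the single vector `u =
⨂ⱼ ⟨fⱼ⟩_Q` in the weak norm recovers `T_Q f`. Thus each constant admissible for `M` is admissible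
for every `T_Q`. -/
theorem muckenhoupt_le_maximalOpNorm (p : Fin m → ℝ≥0∞) (W : ∀ j, E d → H j →L[𝕜] H j) :
    muckenhoupt p W ≤ maximalOpNorm p W := by
  refine iSup₂_le fun Q hQ => le_sInf fun C hC => sInf_le fun f hf => ?_
  have h := hC (fun j => diskMap 𝕜 (f j)) fun j => (hf j).memWBody_diskMap
  simp only [wBodyNorm_diskMap] at h
  refine le_trans ?_ h
  set u := tensor 𝕜 H fun j => avg 𝕜 Q (f j)
  obtain ⟨a, l, hl, rfl⟩ := hQ
  have hu : ∀ x ∈ cube a l, u ∈ maximalOp (fun j => diskMap 𝕜 (f j)) x := fun x hx =>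
    subset_closure <| mem_iUnion₂.2 ⟨cube a l, ⟨a, l, hl, rfl⟩, u, subset_bodyHull _
      ⟨fun j => avg 𝕜 (cube a l) (f j), fun j => ⟨f j, (hf j).1.restrict,
        .of_forall fun y => ⟨1, by simp, one_smul _ _⟩, rfl⟩, rfl⟩, by simp [hx]⟩
  refine le_trans ?_ (le_iSup _ u)
  refine eLpNorm_mono_enorm fun x => ?_
  by_cases hx : x ∈ cube a l
  · have hx' : x ∈ {x | u ∈ maximalOp (fun j => diskMap 𝕜 (f j)) x} := hu x hx
    rw [avgOp, indicator_of_mem hx, indicator_of_mem hx']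
  · rw [avgOp, indicator_of_notMem hx]
    simp

theorem IsMuckenhoupt.maximalBounded {p : Fin m → ℝ≥0∞} (hp : ∀ j, 1 ≤ p j)
    (hW : ∀ j, IsMatrixWeight 𝕜 (W j)) (h : IsMuckenhoupt p W) : MaximalBounded p W := by
  set K : ℝ≥0∞ :=
    2 * ((2 * ∏ j, Module.finrank 𝕜 (H j) + 1 : ℕ) ^ m * (5 ^ (d * m) * muckenhoupt p W))
  have hK : K ≠ ∞ := by
    have := h.2.ne
    finiteness
  refine ⟨K.toNNReal, fun F hF => ⟨fun j => ⟨(hF j).1, fun Q hQ => ?_⟩,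
    measurableSetMap_maximalOp F, ?_⟩⟩
  · exact lintegral_iSup_lt_top_of_memLp_inverse (hp j) (hW j) (h.1 j Q hQ) (hF j)
  · rw [ENNReal.coe_toNNReal hK]
    exact weakNorm_maximalOp_le hp hW h.2 hF

theorem MaximalBounded.isMuckenhoupt {p : Fin m → ℝ≥0∞} (hp : ∀ j, 1 ≤ p j)
    (hW : ∀ j, IsMatrixWeight 𝕜 (W j)) (h : MaximalBounded p W) : IsMuckenhoupt p W := by
  classical
  obtain ⟨C, hC⟩ := h
  refine ⟨fun j Q hQ => ?_, ?_⟩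
  · obtain ⟨a, l, hl, rfl⟩ := hQ
    refine memLp_inverse_of_lintegral_iSup_lt_top (hp j) (hW j) (measurableSet_cube a l)
      (volume_cube_ne_top a l) fun F hF => ?_
    -- Zero in the other slots makes the tuple admissible, so local integrability of `F` alone can
    -- be read off.
    set F' : ∀ j, E d → Set (H j) := Function.update (fun j => diskMap 𝕜 0) j F
    have hF' : ∀ i, MemWBody (p i) (fun x => (W i x : H i →ₗ[𝕜] H i)) (F' i) := by
      intro i
      rcases eq_or_ne i j with rfl | hij
      · simpa [F'] using hF
      · simp only [F', Function.update_of_ne hij]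
        refine MemW.memWBody_diskMap ⟨aestronglyMeasurable_const, ?_⟩
        simp [wNorm]
    have := ((hC F' hF').1 j).2 _ ⟨a, l, hl, rfl⟩
    simpa [F'] using this
  · refine (muckenhoupt_le_maximalOpNorm p W).trans_lt ?_
    exact lt_of_le_of_lt (sInf_le fun F hF => (hC F hF).2.2) (ENNReal.coe_lt_top (r := C))

end Maximal

end TensorMax


theorem mainTheorem9 (d m n : ℕ) (hd : 0 < d) (hm : 0 < m) :
    ∃ C : ℝ≥0, ∀ (𝕜 : Type*) [RCLike 𝕜] (H : Fin m → Type*)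
      [∀ j, NormedAddCommGroup (H j)] [∀ j, InnerProductSpace 𝕜 (H j)]
      [∀ j, FiniteDimensional 𝕜 (H j)],
      ∏ j, Module.finrank 𝕜 (H j) = n →
      ∀ (p : Fin m → ℝ≥0∞) (W : ∀ j, TensorMax.E d → H j →L[𝕜] H j),
        (∀ j, 1 ≤ p j) → (∀ j, TensorMax.IsMatrixWeight 𝕜 (W j)) →
        (TensorMax.IsMuckenhoupt p W ↔ TensorMax.MaximalBounded p W) ∧
        (TensorMax.IsMuckenhoupt p W →
          TensorMax.muckenhoupt p W ≤ C * TensorMax.maximalOpNorm p W ∧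
          TensorMax.maximalOpNorm p W ≤ C * TensorMax.muckenhoupt p W) := by
  -- The factor 2 comes from replacing `u` by `v`, `(2 * n + 1) ^ m` from Carathéodory's theorem
  -- with `1 / p ≤ m`, and `5 ^ (d * m)` from the enlargement of the cubes in each of the `m` slots.
  refine ⟨2 * ((2 * n + 1 : ℕ) ^ m * 5 ^ (d * m)), fun 𝕜 _ H _ _ _ hn p W hp hW =>
    ⟨⟨fun h => h.maximalBounded hp hW, fun h => h.isMuckenhoupt hp hW⟩, fun h => ⟨?_, ?_⟩⟩⟩
  · refine (TensorMax.muckenhoupt_le_maximalOpNorm p W).trans (le_mul_of_one_le_left' ?_)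
    have h1 : (1 : ℝ≥0) ≤ 2 * ((2 * n + 1 : ℕ) ^ m * 5 ^ (d * m)) :=
      one_le_mul one_le_two <| one_le_mul (one_le_pow₀ (by simp)) (one_le_pow₀ (by norm_num))
    exact_mod_cast h1
  · refine sInf_le fun F hF => (TensorMax.weakNorm_maximalOp_le hp hW h.2 hF).trans_eq ?_
    rw [hn]
    push_cast
    simp only [mul_assoc]
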